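/- **Setting.** Let $\Sigma\in\mathbb R^{d\times d}$ be positive definite, $\theta\in\mathbb R^d$ and $\sigma\ge 0$. There are $m$ agents. Agent $i$ has a permutation matrix $\Pi_i=\begin{bmatrix}\Pi_{i+}\\ \Pi_{i-}\end{bmatrix}\in\mathbb R^{d\times d}$ with $\Pi_{i+}\in\mathbb R^{d_i\times d}$ (observed features) and $\Pi_{i-}\in\mathbb R^{(d-d_i)\times d}$ (unobserved features), and every one of the $d$ features is observed by at least one agent. Write $v_{i\pm}=\Pi_{i\pm}v$ for $v \in\mathbb R^d$, and $\Sigma_{i+}=\Pi_{i+}\Sigma\Pi_{i+}^\top$, $\Sigma_{i-}=\Pi_{i-}\Sigma\Pi_{i-}^\top$, $\Sigma_{i\pm}=\Pi_{i+}\Sigma\Pi_{i-}^\top$, $\Sigma_{i\mp}=\Pi_{i-}\Sigma\Pi_{i+}^\top$ for the corresponding blocks. Let $$T_i=\begin{bmatrix} I_{d_i} & \Sigma_{i+}^{-1}\Sigma_{i\pm}\end{bmatrix}\Pi_i,\qquad \Gamma_{i-}=\Sigma_{i-}-\Sigma_{i\mp}\Sigma_{i+}^{-1}\Sigma_{i\pm},\qquad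 \|v\|^2_{A}=\langle v,Av\rangle .$$ Agent $i$ has $n$ samples: a feature matrix $X_i\in\mathbb R^{n\times d}$, of which it observes $X_{i+}=X_i\Pi_{i+}^\top$, and labels $y_i=X_i\theta+\xi_i$. The rows of $X_1,\dots,X_m$ are i.i.d. copies of a square-integrable random vector $x\in\mathbb R^d$ with mean $0$ and covariance $\Sigma$; the entries of the noise vectors $\xi_1,\dots,\xi_m$ are i.i.d. $\mathsf N(0,\sigma^2)$ and independent of the features. For $\alpha_1,\dots,\alpha_m>0$ the global imputation estimator is $$\hat\theta^{\text{imp-glb}}=\Big(\sum_{i=1}^m\alpha_iT_i^\top X_{i+}^\top X_{i+}T_i\Big)^{-1}\Big(\sum_{i=1}^m\alpha_iT_i^\top X_{i+}^\top y_i\Big)$$ (with any fixed convention, here the inverse being $0$, where the matrix is singular). With $z_{i+}=x_{i-}-\Sigma_{i\mp}\Sigma_{i+}^{-1}x_{i+}$ put $$Q_i=\mathbb E\big[x_{i+}\,\theta_{i-}^\top z_{i+}z_{i+}^\top\theta_{i-}\,x_{i+}^\top\big]+\sigma^2\Sigma_{i+},\qquad W_i^\star=\Sigma_{i+}Q_i^{-1}\Sigma_{i+},\qquad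 C^\star=\Big(\sum_{i=1}^mT_i^\top W_i^\star T_i\Big)^{-1},$$ $$C^{\text{imp-glb}}(\alpha_1,\dots,\alpha_m)=\Big(\sum_{i=1}^m\alpha_iT_i^\top\Sigma_{i+}T_i\Big)^{-1}\Big(\sum_{i=1}^m\alpha_i^2T_i^\top Q_iT_i\Big)\Big(\sum_{i=1}^m\alpha_iT_i^\top\Sigma_{i+}T_i\Big)^{-1}.$$ **Theorem.** 1. (Consistency.) For all $\alpha_1,\dots,\alpha_m>0$, $\hat\theta^{\text{imp-glb}}\to\theta$ in probability as $n\to\infty$. 2. (Asymptotic normality.) If $\mathbb E\big[\|x_{i+}\|^2(\theta_{i-}^\top z_{i+})^2\big]<\infty$ for every $i$ (so that the $Q_i$ exist), then for all $\alpha_1,\dots,\alpha_m>0$ the matrix $C^{\text{imp-glb}}(\alpha_1,\dots,\alpha_m)$ is positive semidefinite and $$\sqrt n\,\big(\hat\theta^{\text{imp-glb}}-\theta\big)\xrightarrow{d}\mathsf N\big(0,C^{\text{imp-glb}}(\alpha_1,\dots,\alpha_m)\big).$$ 3. (Gaussian features.) If $x\sim\mathsf N(0,\Sigma)$, then the moment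 condition in 2 holds for every $i$. If moreover $\|\theta_{i-}\|^2_{\Gamma_{i-}}+\sigma^2>0$ for every $i$ (for instance if $\sigma>0$), then in the positive semidefinite order $C^{\text{imp-glb}}(\alpha_1,\dots,\alpha_m)\succeq C^\star$ for all $\alpha_1,\dots,\alpha_m>0$, with equality when $\alpha_i=1/(\|\theta_{i-}\|^2_{\Gamma_{i-}}+\sigma^2)$ for every $i$. -/

import Mathlib

open MeasureTheory ProbabilityTheory Filter Topology
open scoped Matrix

noncomputable section

namespace Collab

/-! ### Views

A view of `d` features in which `p` features are observed and `q` are unobserved is a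
bijection `π : Fin p ⊕ Fin q ≃ Fin d`; it encodes the permutation matrix `Π = [Π₊; Π₋]`. -/

section View

variable {d p q : ℕ}

/-- `Π₊`, the rows of the permutation matrix that select the observed features. -/
def viewPlus (π : Fin p ⊕ Fin q ≃ Fin d) : Matrix (Fin p) (Fin d) ℝ :=
  (1 : Matrix (Fin d) (Fin d) ℝ).submatrix (fun a => π (Sum.inl a)) id

/-- `Π₋`, the rows of the permutation matrix that select the unobserved features. -/
def viewMinus (π : Fin p ⊕ Fin q ≃ Fin d) : Matrix (Fin q) (Fin d) ℝ :=
  (1 : Matrix (Fin d) (Fin d) ℝ).submatrix (fun b => π (Sum.inr b)) id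

/-- `A₊ = Π₊ A Π₊ᵀ`. -/
def blockPlus (π : Fin p ⊕ Fin q ≃ Fin d) (A : Matrix (Fin d) (Fin d) ℝ) :
    Matrix (Fin p) (Fin p) ℝ :=
  viewPlus π * A * (viewPlus π)ᵀ

/-- `A₋ = Π₋ A Π₋ᵀ`. -/
def blockMinus (π : Fin p ⊕ Fin q ≃ Fin d) (A : Matrix (Fin d) (Fin d) ℝ) :
    Matrix (Fin q) (Fin q) ℝ :=
  viewMinus π * A * (viewMinus π)ᵀ

/-- `A± = Π₊ A Π₋ᵀ`. -/
def blockPlusMinus (π : Fin p ⊕ Fin q ≃ Fin d) (A : Matrix (Fin d) (Fin d) ℝ) :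
    Matrix (Fin p) (Fin q) ℝ :=
  viewPlus π * A * (viewMinus π)ᵀ

/-- `A∓ = Π₋ A Π₊ᵀ`. -/
def blockMinusPlus (π : Fin p ⊕ Fin q ≃ Fin d) (A : Matrix (Fin d) (Fin d) ℝ) :
    Matrix (Fin q) (Fin p) ℝ :=
  viewMinus π * A * (viewPlus π)ᵀ

/-- The imputation matrix `T = [I  Σ₊⁻¹ Σ±] Π`. -/
def imputeMat (π : Fin p ⊕ Fin q ≃ Fin d) (S : Matrix (Fin d) (Fin d) ℝ) :
    Matrix (Fin p) (Fin d) ℝ :=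
  Matrix.fromCols (1 : Matrix (Fin p) (Fin p) ℝ) ((blockPlus π S)⁻¹ * blockPlusMinus π S) *
    Matrix.fromRows (viewPlus π) (viewMinus π)

/-- The Schur complement `Γ₋ = Σ₋ - Σ∓ Σ₊⁻¹ Σ±`. -/
def schurMinus (π : Fin p ⊕ Fin q ≃ Fin d) (S : Matrix (Fin d) (Fin d) ℝ) :
    Matrix (Fin q) (Fin q) ℝ :=
  blockMinus π S - blockMinusPlus π S * (blockPlus π S)⁻¹ * blockPlusMinus π S

/-- The squared seminorm `‖v‖²_A = ⟨v, A v⟩`. -/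
def quadForm {ι : Type*} [Fintype ι] (A : Matrix ι ι ℝ) (v : ι → ℝ) : ℝ :=
  v ⬝ᵥ (A *ᵥ v)

/-- `‖θ₋‖²_{Γ₋} + σ²`. -/
def residualVar (π : Fin p ⊕ Fin q ≃ Fin d) (S : Matrix (Fin d) (Fin d) ℝ) (σ : ℝ)
    (θ : EuclideanSpace ℝ (Fin d)) : ℝ :=
  quadForm (schurMinus π S) (viewMinus π *ᵥ θ) + σ ^ 2

/-- The residual `z = x₋ - Σ∓ Σ₊⁻¹ x₊` of the best linear prediction of `x₋` from `x₊`. -/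
def residual (π : Fin p ⊕ Fin q ≃ Fin d) (S : Matrix (Fin d) (Fin d) ℝ)
    (x : EuclideanSpace ℝ (Fin d)) : Fin q → ℝ :=
  viewMinus π *ᵥ x - (blockMinusPlus π S * (blockPlus π S)⁻¹) *ᵥ (viewPlus π *ᵥ x)

/-- `Q = E[x₊ (θ₋ᵀ z)(zᵀ θ₋) x₊ᵀ] + σ² Σ₊`, where `x` has law `P`. -/
def scoreCov (π : Fin p ⊕ Fin q ≃ Fin d) (S : Matrix (Fin d) (Fin d) ℝ) (σ : ℝ)
    (θ : EuclideanSpace ℝ (Fin d)) (P : Measure (EuclideanSpace ℝ (Fin d))) :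
    Matrix (Fin p) (Fin p) ℝ :=
  Matrix.of (fun a b => ∫ x : EuclideanSpace ℝ (Fin d), (viewPlus π *ᵥ x) a *
      ((viewMinus π *ᵥ θ) ⬝ᵥ residual π S x) ^ 2 * (viewPlus π *ᵥ x) b ∂P) +
    σ ^ 2 • blockPlus π S

/-- `E[‖x₊‖² (θ₋ᵀ z)²] < ∞`, that is, the expectation in `scoreCov` exists. -/
def HasScoreCov (π : Fin p ⊕ Fin q ≃ Fin d) (S : Matrix (Fin d) (Fin d) ℝ)
    (θ : EuclideanSpace ℝ (Fin d)) (P : Measure (EuclideanSpace ℝ (Fin d))) : Prop :=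
  Integrable (fun x : EuclideanSpace ℝ (Fin d) => ((viewPlus π *ᵥ x) ⬝ᵥ (viewPlus π *ᵥ x)) *
    ((viewMinus π *ᵥ θ) ⬝ᵥ residual π S x) ^ 2) P

/-- The weight matrix `W⋆ = Σ₊ Q⁻¹ Σ₊`. -/
def optWeight (π : Fin p ⊕ Fin q ≃ Fin d) (S : Matrix (Fin d) (Fin d) ℝ) (σ : ℝ)
    (θ : EuclideanSpace ℝ (Fin d)) (P : Measure (EuclideanSpace ℝ (Fin d))) :
    Matrix (Fin p) (Fin p) ℝ :=
  blockPlus π S * (scoreCov π S σ θ P)⁻¹ * blockPlus π S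

end View

/-! ### Several agents: agent `i` observes `r i` of the `d` features -/

section Agents

variable {m d : ℕ} {r : Fin m → ℕ}

/-- `C⋆ = (∑ᵢ Tᵢᵀ Wᵢ⋆ Tᵢ)⁻¹`. -/
def optCov (π : ∀ i, Fin (r i) ⊕ Fin (d - r i) ≃ Fin d) (S : Matrix (Fin d) (Fin d) ℝ) (σ : ℝ)
    (θ : EuclideanSpace ℝ (Fin d)) (P : Measure (EuclideanSpace ℝ (Fin d))) :
    Matrix (Fin d) (Fin d) ℝ :=
  (∑ i, (imputeMat (π i) S)ᵀ * optWeight (π i) S σ θ P * imputeMat (π i) S)⁻¹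

/-- `C^{imp-glb}(α) = (∑ᵢ αᵢ Tᵢᵀ Σᵢ₊ Tᵢ)⁻¹ (∑ᵢ αᵢ² Tᵢᵀ Qᵢ Tᵢ) (∑ᵢ αᵢ Tᵢᵀ Σᵢ₊ Tᵢ)⁻¹`. -/
def impGlbCov (π : ∀ i, Fin (r i) ⊕ Fin (d - r i) ≃ Fin d) (S : Matrix (Fin d) (Fin d) ℝ)
    (σ : ℝ) (θ : EuclideanSpace ℝ (Fin d)) (P : Measure (EuclideanSpace ℝ (Fin d)))
    (α : Fin m → ℝ) : Matrix (Fin d) (Fin d) ℝ :=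
  (∑ i, α i • ((imputeMat (π i) S)ᵀ * blockPlus (π i) S * imputeMat (π i) S))⁻¹ *
    (∑ i, α i ^ 2 • ((imputeMat (π i) S)ᵀ * scoreCov (π i) S σ θ P * imputeMat (π i) S)) *
    (∑ i, α i • ((imputeMat (π i) S)ᵀ * blockPlus (π i) S * imputeMat (π i) S))⁻¹

/-- The global imputation estimator
`(∑ᵢ αᵢ Tᵢᵀ Xᵢ₊ᵀ Xᵢ₊ Tᵢ)⁻¹ (∑ᵢ αᵢ Tᵢᵀ Xᵢ₊ᵀ yᵢ)`, a function of the observed features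
`Xᵢ₊` and the labels `yᵢ`. -/
def impGlb {n : ℕ} (T : ∀ i, Matrix (Fin (r i)) (Fin d) ℝ) (α : Fin m → ℝ)
    (X : ∀ i, Matrix (Fin n) (Fin (r i)) ℝ) (y : Fin m → Fin n → ℝ) :
    EuclideanSpace ℝ (Fin d) :=
  WithLp.toLp 2 ((∑ i, α i • ((T i)ᵀ * (X i)ᵀ * X i * T i))⁻¹ *ᵥ
    (∑ i, α i • (((T i)ᵀ * (X i)ᵀ) *ᵥ y i)))

/-- The matrix whose rows are the first `n` feature vectors of an infinite sample. -/
def designMat (n : ℕ) (x : ℕ → EuclideanSpace ℝ (Fin d)) : Matrix (Fin n) (Fin d) ℝ :=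
  Matrix.of fun k j => x k j

/-- The global imputation estimator of the linear model `yᵢ = Xᵢ θ + εᵢ` after `n` samples per
agent, where `x i k` and `ε i k` are the `k`-th feature vector and the `k`-th noise variable of
agent `i`. -/
def impGlbEstimator (π : ∀ i, Fin (r i) ⊕ Fin (d - r i) ≃ Fin d)
    (S : Matrix (Fin d) (Fin d) ℝ) (θ : EuclideanSpace ℝ (Fin d)) (α : Fin m → ℝ) (n : ℕ)
    (x : Fin m → ℕ → EuclideanSpace ℝ (Fin d)) (ε : Fin m → ℕ → ℝ) :
    EuclideanSpace ℝ (Fin d) :=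
  impGlb (fun i => imputeMat (π i) S) α
    (fun i => designMat n (x i) * (viewPlus (π i))ᵀ)
    (fun i => designMat n (x i) *ᵥ θ + fun k : Fin n => ε i k)

end Agents

end Collab

end

/-!
Write `x₊` for the observed part of `x` and `T` for the imputation matrix. Then
`⟨x, θ⟩ = ⟨x₊, T θ⟩ + ⟨θ₋, z⟩`, and the residual `z` is uncorrelated with `x₊`. Hence each agent
contributes a score `(⟨θ₋, z⟩ + ε) x₊` of mean zero and covariance `Q`, and the estimation error
solves the normal equations `Ĝ (θ̂ - θ) = n⁻¹ ∑ₖ gₖ`, where the `gₖ` are i.i.d. sums of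
`αᵢ Tᵢᵀ` times the scores and `Ĝ` is the empirical version of `∑ᵢ αᵢ Tᵢᵀ Σᵢ₊ Tᵢ`, which is
positive definite because every feature is observed. The law of large numbers for `Ĝ` and `gₖ`
gives consistency; the central limit theorem for `gₖ` (by the Cramér–Wold device) and Slutsky's
lemma give normality.

The bound `C⋆` is the Gauss–Markov inequality. For Gaussian features `z` is independent of `x₊`,
so `Q = (‖θ₋‖²_{Γ₋} + σ²) Σ₊` and the weights `αᵢ` inverse to these factors attain it.
-/

namespace Collab

section GaussMarkov

variable {K ι n : Type*} {κ : ι → Type*} [Field K]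
  [PartialOrder K] [StarRing K] [IsOrderedAddMonoid K] [Fintype ι] [Fintype n]
  [∀ i, Fintype (κ i)] {Q : ∀ i, Matrix (κ i) (κ i) K} {B G : ∀ i, Matrix (κ i) n K}

theorem posDef_sum_conjTranspose_mul_mul (hQ : ∀ i, (Q i).PosDef)
    (hB : ∀ v, (∀ i, B i *ᵥ v = 0) → v = 0) : (∑ i, (B i)ᴴ * Q i * B i).PosDef := by
  have hpsd : ∀ i ∈ Finset.univ, ((B i)ᴴ * Q i * B i).PosSemidef :=
    fun i _ => (hQ i).posSemidef.conjTranspose_mul_mul_same (B i)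
  refine .of_dotProduct_mulVec_pos (Matrix.posSemidef_sum _ hpsd).isHermitian fun v hv => ?_
  obtain ⟨i, hi⟩ : ∃ i, B i *ᵥ v ≠ 0 := by
    contrapose! hv
    exact hB v hv
  have hterm : ∀ i, star v ⬝ᵥ ((B i)ᴴ * Q i * B i) *ᵥ v
      = star (B i *ᵥ v) ⬝ᵥ Q i *ᵥ (B i *ᵥ v) := fun i => by
    rw [Matrix.star_mulVec, ← Matrix.dotProduct_mulVec, Matrix.mulVec_mulVec,
      Matrix.mulVec_mulVec, Matrix.mul_assoc]
  rw [Matrix.sum_mulVec, dotProduct_sum]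
  exact Finset.sum_pos' (fun i hi => (hpsd i hi).dotProduct_mulVec_nonneg v)
    ⟨i, Finset.mem_univ i, hterm i ▸ (hQ i).dotProduct_mulVec_pos hi⟩

variable [∀ i, DecidableEq (κ i)] [DecidableEq n]

/- Here `B i` and `Q i` are the design and the noise covariance of the `i`-th block of observations,
and `G i` the weights of a linear unbiased estimator. The difference of covariances is that of the
deviations `G i - (Q i)⁻¹ B i C` from the weights of the optimal estimator. -/
theorem posSemidef_gaussMarkov (hQ : ∀ i, (Q i).PosDef) (hG : ∑ i, (G i)ᴴ * B i = 1) :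
    ((∑ i, (G i)ᴴ * Q i * G i) - (∑ i, (B i)ᴴ * (Q i)⁻¹ * B i)⁻¹).PosSemidef := by
  have hB : ∀ v, (∀ i, B i *ᵥ v = 0) → v = 0 := fun v hv => by
    rw [← Matrix.one_mulVec v, ← hG]
    simp [Matrix.sum_mulVec, ← Matrix.mulVec_mulVec, hv]
  have hN := posDef_sum_conjTranspose_mul_mul (fun i => (hQ i).inv) hB
  set N := ∑ i, (B i)ᴴ * (Q i)⁻¹ * B i with hN_def
  have hG' : ∑ i, (B i)ᴴ * G i = 1 := by
    simpa [Matrix.conjTranspose_sum] using congrArg Matrix.conjTranspose hG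
  have hCt : (N⁻¹)ᴴ = N⁻¹ := hN.inv.isHermitian
  have hterm : ∀ i, (G i - (Q i)⁻¹ * B i * N⁻¹)ᴴ * Q i * (G i - (Q i)⁻¹ * B i * N⁻¹)
      = (G i)ᴴ * Q i * G i - (G i)ᴴ * B i * N⁻¹ - N⁻¹ * ((B i)ᴴ * G i)
        + N⁻¹ * ((B i)ᴴ * (Q i)⁻¹ * B i) * N⁻¹ := fun i => by
    have hQu : IsUnit (Q i).det := (Matrix.isUnit_iff_isUnit_det _).1 (hQ i).isUnit
    have hQt : ((Q i)⁻¹)ᴴ = (Q i)⁻¹ := (hQ i).inv.isHermitian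
    simp only [Matrix.conjTranspose_sub, Matrix.conjTranspose_mul, hQt, hCt, Matrix.sub_mul,
      Matrix.mul_sub, Matrix.mul_assoc, Matrix.mul_nonsing_inv_cancel_left _ _ hQu,
      Matrix.nonsing_inv_mul_cancel_left _ _ hQu]
    abel
  have hsum : ∑ i, (G i - (Q i)⁻¹ * B i * N⁻¹)ᴴ * Q i * (G i - (Q i)⁻¹ * B i * N⁻¹)
      = (∑ i, (G i)ᴴ * Q i * G i) - N⁻¹ := by
    have hNu : IsUnit N.det := (Matrix.isUnit_iff_isUnit_det _).1 hN.isUnit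
    simp only [hterm, Finset.sum_add_distrib, Finset.sum_sub_distrib, ← Matrix.sum_mul,
      ← Matrix.mul_sum, hG, hG', ← hN_def, Matrix.nonsing_inv_mul _ hNu]
    simp
  exact hsum ▸ Matrix.posSemidef_sum _ fun i _ =>
    (hQ i).posSemidef.conjTranspose_mul_mul_same _

end GaussMarkov

section View

variable {d p q : ℕ} (π : Fin p ⊕ Fin q ≃ Fin d) {S : Matrix (Fin d) (Fin d) ℝ}

theorem viewPlus_mulVec_apply (v : Fin d → ℝ) (a : Fin p) :
    (viewPlus π *ᵥ v) a = v (π (Sum.inl a)) := by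
  simp [viewPlus, Matrix.mulVec, dotProduct, Matrix.one_apply]

theorem transpose_viewPlus_mul_add_transpose_viewMinus_mul :
    (viewPlus π)ᵀ * viewPlus π + (viewMinus π)ᵀ * viewMinus π = 1 := by
  ext j l
  have h := π.sum_comp fun k =>
    (1 : Matrix (Fin d) (Fin d) ℝ) k j * (1 : Matrix (Fin d) (Fin d) ℝ) k l
  rw [Fintype.sum_sum_type] at h
  refine Eq.trans h ?_
  simp [Matrix.one_apply, eq_comm]

theorem blockPlus_eq_submatrix (A : Matrix (Fin d) (Fin d) ℝ) :
    blockPlus π A = A.submatrix (π ∘ Sum.inl) (π ∘ Sum.inl) := by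
  ext a b
  simp [blockPlus, viewPlus, Matrix.mul_apply, Matrix.one_apply]

theorem posDef_blockPlus (hS : S.PosDef) : (blockPlus π S).PosDef :=
  blockPlus_eq_submatrix π S ▸ hS.submatrix (π.injective.comp Sum.inl_injective)

theorem isUnit_det_blockPlus (hS : S.PosDef) : IsUnit (blockPlus π S).det :=
  (Matrix.isUnit_iff_isUnit_det _).1 (posDef_blockPlus π hS).isUnit

theorem imputeMat_eq :
    imputeMat π S = viewPlus π + (blockPlus π S)⁻¹ * blockPlusMinus π S * viewMinus π := by
  rw [imputeMat, Matrix.fromCols_mul_fromRows, Matrix.one_mul]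

theorem blockPlus_mul_imputeMat (hS : S.PosDef) :
    blockPlus π S * imputeMat π S = viewPlus π * S := by
  rw [imputeMat_eq, Matrix.mul_add, Matrix.mul_assoc (blockPlus π S)⁻¹,
    Matrix.mul_nonsing_inv_cancel_left _ _ (isUnit_det_blockPlus π hS), blockPlus, blockPlusMinus]
  simp only [Matrix.mul_assoc, ← Matrix.mul_add]
  rw [transpose_viewPlus_mul_add_transpose_viewMinus_mul, Matrix.mul_one]

/-- The matrix `R = Π₋ - Σ∓ Σ₊⁻¹ Π₊` of the linear map `x ↦ z` that sends the features to the
residual. -/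
noncomputable def residualMat (S : Matrix (Fin d) (Fin d) ℝ) : Matrix (Fin q) (Fin d) ℝ :=
  viewMinus π - blockMinusPlus π S * (blockPlus π S)⁻¹ * viewPlus π

theorem residual_eq_mulVec (x : EuclideanSpace ℝ (Fin d)) :
    residual π S x = residualMat π S *ᵥ x := by
  rw [residual, residualMat, Matrix.sub_mulVec, Matrix.mulVec_mulVec]

theorem transpose_residualMat (hS : S.IsHermitian) :
    (residualMat π S)ᵀ
      = (viewMinus π)ᵀ - (viewPlus π)ᵀ * ((blockPlus π S)⁻¹ * blockPlusMinus π S) := by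
  have hSt : Sᵀ = S := hS
  simp [residualMat, blockPlus, blockMinusPlus, blockPlusMinus, Matrix.transpose_nonsing_inv,
    hSt, Matrix.mul_assoc]

theorem transpose_viewPlus_mul_imputeMat_add (hS : S.IsHermitian) :
    (viewPlus π)ᵀ * imputeMat π S + (residualMat π S)ᵀ * viewMinus π = 1 := by
  rw [imputeMat_eq, transpose_residualMat π hS, Matrix.mul_add, Matrix.sub_mul,
    ← transpose_viewPlus_mul_add_transpose_viewMinus_mul π]
  simp only [Matrix.mul_assoc]
  abel

theorem viewPlus_mul_mul_transpose_residualMat (hS : S.PosDef) :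
    viewPlus π * S * (residualMat π S)ᵀ = 0 := by
  rw [transpose_residualMat π hS.isHermitian, Matrix.mul_sub, ← Matrix.mul_assoc (viewPlus π * S)]
  exact sub_eq_zero.2
    (Matrix.mul_nonsing_inv_cancel_left _ (blockPlusMinus π S) (isUnit_det_blockPlus π hS)).symm

theorem residualMat_mul_mul_transpose (hS : S.PosDef) :
    residualMat π S * S * (residualMat π S)ᵀ = schurMinus π S := by
  nth_rw 1 [residualMat]
  rw [Matrix.sub_mul, Matrix.sub_mul, Matrix.mul_assoc _ (viewPlus π), Matrix.mul_assoc _ (_ * _),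
    viewPlus_mul_mul_transpose_residualMat π hS, Matrix.mul_zero, sub_zero,
    transpose_residualMat π hS.isHermitian, Matrix.mul_sub]
  simp only [schurMinus, blockMinus, blockMinusPlus, Matrix.mul_assoc]

variable (θ : Fin d → ℝ)

/-- The vector `g = Rᵀ θ₋`, for which `⟨θ₋, z⟩ = ⟨g, x⟩`. -/
noncomputable def residualDir (S : Matrix (Fin d) (Fin d) ℝ) : Fin d → ℝ :=
  (residualMat π S)ᵀ *ᵥ (viewMinus π *ᵥ θ)

theorem dotProduct_residual (x : EuclideanSpace ℝ (Fin d)) :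
    (viewMinus π *ᵥ θ) ⬝ᵥ residual π S x = residualDir π θ S ⬝ᵥ x := by
  rw [residual_eq_mulVec, residualDir, Matrix.dotProduct_mulVec, Matrix.mulVec_transpose]

theorem viewPlus_mulVec_mulVec_residualDir (hS : S.PosDef) :
    viewPlus π *ᵥ (S *ᵥ residualDir π θ S) = 0 := by
  rw [residualDir, Matrix.mulVec_mulVec, Matrix.mulVec_mulVec,
    viewPlus_mul_mul_transpose_residualMat π hS, Matrix.zero_mulVec]

theorem quadForm_residualDir (hS : S.PosDef) :
    quadForm S (residualDir π θ S) = quadForm (schurMinus π S) (viewMinus π *ᵥ θ) := by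
  rw [quadForm, quadForm, residualDir, ← residualMat_mul_mul_transpose π hS,
    Matrix.mulVec_transpose, ← Matrix.dotProduct_mulVec, ← Matrix.mulVec_transpose]
  simp only [Matrix.mulVec_mulVec, Matrix.mul_assoc]

theorem dotProduct_eq_add_residualDir (hS : S.IsHermitian) (x : Fin d → ℝ) :
    x ⬝ᵥ θ = (viewPlus π *ᵥ x) ⬝ᵥ (imputeMat π S *ᵥ θ) + residualDir π θ S ⬝ᵥ x := by
  conv_lhs => rw [← Matrix.one_mulVec θ, ← transpose_viewPlus_mul_imputeMat_add π hS]
  rw [Matrix.add_mulVec, dotProduct_add, dotProduct_comm (residualDir π θ S), residualDir,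
    ← Matrix.mulVec_mulVec, ← Matrix.mulVec_mulVec, Matrix.dotProduct_mulVec x,
    Matrix.vecMul_transpose]

end View

section Agents

variable {m d : ℕ} {r : Fin m → ℕ} {π : ∀ i, Fin (r i) ⊕ Fin (d - r i) ≃ Fin d}
  {S : Matrix (Fin d) (Fin d) ℝ}

/-- The matrix `∑ᵢ αᵢ Tᵢᵀ Πᵢ₊ Aᵢ Πᵢ₊ᵀ Tᵢ` of the normal equations of the global imputation
estimator, where `Aᵢ` is the Gram matrix `Xᵢᵀ Xᵢ`, or its population counterpart `Σ`. -/
noncomputable def imputedGram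
    (π : ∀ i, Fin (r i) ⊕ Fin (d - r i) ≃ Fin d) (S : Matrix (Fin d) (Fin d) ℝ)
    (α : Fin m → ℝ) (A : Fin m → Matrix (Fin d) (Fin d) ℝ) : Matrix (Fin d) (Fin d) ℝ :=
  ∑ i, α i • ((imputeMat (π i) S)ᵀ * blockPlus (π i) (A i) * imputeMat (π i) S)

@[fun_prop]
theorem continuous_imputedGram (α : Fin m → ℝ) : Continuous (imputedGram π S α) := by
  unfold imputedGram blockPlus
  fun_prop

theorem imputedGram_smul (α : Fin m → ℝ) (c : ℝ) (A : Fin m → Matrix (Fin d) (Fin d) ℝ) :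
    imputedGram π S α (c • A) = c • imputedGram π S α A := by
  simp [imputedGram, blockPlus, Finset.smul_sum, smul_comm c]

theorem eq_zero_of_forall_imputeMat_mulVec_eq_zero (hS : S.PosDef)
    (hcover : ∀ j : Fin d, ∃ (i : Fin m) (a : Fin (r i)), π i (Sum.inl a) = j) {v : Fin d → ℝ}
    (hv : ∀ i, imputeMat (π i) S *ᵥ v = 0) : v = 0 := by
  have hSv : S *ᵥ v = 0 := funext fun j => by
    obtain ⟨i, a, rfl⟩ := hcover j
    rw [← viewPlus_mulVec_apply (π i) (S *ᵥ v) a, Matrix.mulVec_mulVec,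
      ← blockPlus_mul_imputeMat _ hS, ← Matrix.mulVec_mulVec, hv, Matrix.mulVec_zero,
      Pi.zero_apply, Pi.zero_apply]
  exact Matrix.eq_zero_of_mulVec_eq_zero hS.det_pos.ne' hSv

theorem posDef_imputedGram (hS : S.PosDef)
    (hcover : ∀ j : Fin d, ∃ (i : Fin m) (a : Fin (r i)), π i (Sum.inl a) = j) {α : Fin m → ℝ}
    (hα : ∀ i, 0 < α i) : (imputedGram π S α fun _ => S).PosDef := by
  simpa [imputedGram] using posDef_sum_conjTranspose_mul_mul
    (fun i => (posDef_blockPlus (π i) hS).smul (hα i))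
    fun v => eq_zero_of_forall_imputeMat_mulVec_eq_zero hS hcover

variable {σ : ℝ} {θ : EuclideanSpace ℝ (Fin d)} {P : Measure (EuclideanSpace ℝ (Fin d))}

theorem posSemidef_impGlbCov_sub_optCov (hS : S.PosDef)
    (hcover : ∀ j : Fin d, ∃ (i : Fin m) (a : Fin (r i)), π i (Sum.inl a) = j)
    (hQ : ∀ i, (scoreCov (π i) S σ θ P).PosDef) {α : Fin m → ℝ} (hα : ∀ i, 0 < α i) :
    (impGlbCov π S σ θ P α - optCov π S σ θ P).PosSemidef := by
  have hH := posDef_imputedGram hS hcover hα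
  set H := imputedGram π S α fun _ => S with hH_def
  have hHt : (H⁻¹)ᵀ = H⁻¹ := hH.inv.isHermitian
  have hplus : ∀ i, (blockPlus (π i) S)ᵀ = blockPlus (π i) S := fun i =>
    (posDef_blockPlus (π i) hS).isHermitian
  have hunbiased : ∑ i, (α i • imputeMat (π i) S * H⁻¹)ᴴ * (blockPlus (π i) S * imputeMat (π i) S)
      = 1 := by
    rw [← Matrix.nonsing_inv_mul H ((Matrix.isUnit_iff_isUnit_det _).1 hH.isUnit)]
    nth_rw 3 [hH_def]
    simp [imputedGram, hHt, Matrix.mul_sum, Matrix.mul_assoc]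
  have hcov : impGlbCov π S σ θ P α = ∑ i, (α i • imputeMat (π i) S * H⁻¹)ᴴ *
      scoreCov (π i) S σ θ P * (α i • imputeMat (π i) S * H⁻¹) := by
    change H⁻¹ * _ * H⁻¹ = _
    simp [Matrix.mul_sum, Matrix.sum_mul, hHt, smul_smul, sq, Matrix.mul_assoc]
  have hopt : optCov π S σ θ P = (∑ i, (blockPlus (π i) S * imputeMat (π i) S)ᴴ *
      (scoreCov (π i) S σ θ P)⁻¹ * (blockPlus (π i) S * imputeMat (π i) S))⁻¹ := by
    simp [optCov, optWeight, hplus, Matrix.mul_assoc]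
  rw [hcov, hopt]
  exact posSemidef_gaussMarkov hQ hunbiased

theorem impGlbCov_inv_eq_optCov (hS : S.PosDef)
    (hcover : ∀ j : Fin d, ∃ (i : Fin m) (a : Fin (r i)), π i (Sum.inl a) = j) {c : Fin m → ℝ}
    (hc : ∀ i, 0 < c i) (hQ : ∀ i, scoreCov (π i) S σ θ P = c i • blockPlus (π i) S) :
    impGlbCov π S σ θ P (fun i => (c i)⁻¹) = optCov π S σ θ P := by
  have hH := posDef_imputedGram hS hcover fun i => inv_pos.2 (hc i)
  have hsum : ∑ i, (c i)⁻¹ ^ 2 • ((imputeMat (π i) S)ᵀ * scoreCov (π i) S σ θ P *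
      imputeMat (π i) S) = imputedGram π S (fun i => (c i)⁻¹) fun _ => S :=
    Finset.sum_congr rfl fun i _ => by
      simp [hQ, smul_smul, sq, (hc i).ne']
  have hweight : ∀ i, optWeight (π i) S σ θ P = (c i)⁻¹ • blockPlus (π i) S := fun i => by
    have hu := isUnit_det_blockPlus (π i) hS
    have hinv : (c i • blockPlus (π i) S)⁻¹ = (c i)⁻¹ • (blockPlus (π i) S)⁻¹ :=
      Matrix.inv_smul' _ (Units.mk0 (c i) (hc i).ne') hu
    simp [optWeight, hQ, hinv, Matrix.mul_nonsing_inv _ hu]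
  have hopt : optCov π S σ θ P = (imputedGram π S (fun i => (c i)⁻¹) fun _ => S)⁻¹ := by
    simp [optCov, imputedGram, hweight]
  rw [impGlbCov, hsum, hopt]
  change (imputedGram π S (fun i => (c i)⁻¹) fun _ => S)⁻¹ * _ * _⁻¹ = _
  rw [Matrix.nonsing_inv_mul _ ((Matrix.isUnit_iff_isUnit_det _).1 hH.isUnit), Matrix.one_mul]
  rfl

end Agents

section Convergence

open scoped InnerProductSpace

theorem charFun_map_apply_eq_charFun_map_inner {Ω E : Type*} [MeasurableSpace Ω] {μ : Measure Ω}
    [NormedAddCommGroup E] [InnerProductSpace ℝ E] [MeasurableSpace E]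
    [OpensMeasurableSpace E] {X : Ω → E} (hX : AEMeasurable X μ) (t : E) :
    charFun (μ.map X) t = charFun (μ.map fun ω => ⟪t, X ω⟫_ℝ) 1 := by
  rw [charFun_apply, charFun_apply, integral_map hX, integral_map (by fun_prop)]
  · simp [real_inner_comm]
  all_goals fun_prop

variable {Ω Ω' E : Type*} [MeasurableSpace Ω] [MeasurableSpace Ω'] {μ : Measure Ω}
  {μ' : Measure Ω'} [IsProbabilityMeasure μ] [IsProbabilityMeasure μ']
  [NormedAddCommGroup E] [InnerProductSpace ℝ E] [FiniteDimensional ℝ E] [MeasurableSpace E]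
  [BorelSpace E]

theorem tendstoInDistribution_of_forall_inner {X : ℕ → Ω → E} {Y : Ω' → E}
    (hX : ∀ n, AEMeasurable (X n) μ) (hY : AEMeasurable Y μ')
    (h : ∀ t : E, TendstoInDistribution (fun n ω => ⟪t, X n ω⟫_ℝ) atTop (fun ω => ⟪t, Y ω⟫_ℝ)
      (fun _ => μ) μ') :
    TendstoInDistribution X atTop Y (fun _ => μ) μ' where
  forall_aemeasurable := hX
  aemeasurable_limit := hY
  tendsto := ProbabilityMeasure.tendsto_iff_tendsto_charFun.2 fun t => by
    simpa [charFun_map_apply_eq_charFun_map_inner, hX, hY] using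
      ProbabilityMeasure.tendsto_iff_tendsto_charFun.1 (h t).tendsto 1

theorem tendstoInDistribution_inv_sqrt_smul_sum {X : ℕ → Ω → E} {Y : Ω' → E}
    (hindep : iIndepFun X μ) (hident : ∀ k, IdentDistrib (X k) (X 0) μ μ) (hX : MemLp (X 0) 2 μ)
    (hXmean : ∀ t, ∫ ω, ⟪t, X 0 ω⟫_ℝ ∂μ = 0) (hY : HasGaussianLaw Y μ')
    (hYmean : ∀ t, ∫ ω, ⟪t, Y ω⟫_ℝ ∂μ' = 0)
    (hvar : ∀ t, Var[fun ω => ⟪t, Y ω⟫_ℝ; μ'] = Var[fun ω => ⟪t, X 0 ω⟫_ℝ; μ]) :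
    TendstoInDistribution (fun (n : ℕ) ω => (√(n : ℝ))⁻¹ • ∑ k ∈ Finset.range n, X k ω) atTop Y
      (fun _ => μ) μ' := by
  have hXm : ∀ k, AEMeasurable (X k) μ := fun k => (hident k).aemeasurable_fst
  refine tendstoInDistribution_of_forall_inner (fun n => by fun_prop) hY.aemeasurable fun t => ?_
  have hYt : HasGaussianLaw (fun ω => ⟪t, Y ω⟫_ℝ) μ' := hY.map_fun (innerSL ℝ t)
  have hYlaw : HasLaw (fun ω => ⟪t, Y ω⟫_ℝ)
      (gaussianReal 0 Var[fun ω => ⟪t, X 0 ω⟫_ℝ; μ].toNNReal) μ' :=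
    ⟨hYt.aemeasurable, by rw [hYt.map_eq_gaussianReal, hYmean, hvar]⟩
  have hinner : Measurable fun x : E => ⟪t, x⟫_ℝ := by fun_prop
  have hclt := tendstoInDistribution_inv_sqrt_mul_sum_sub (X := fun k ω => ⟪t, X k ω⟫_ℝ) hYlaw
    (hX.const_inner t) (hindep.comp (fun _ x => ⟪t, x⟫_ℝ) fun _ => hinner)
    fun k => (hident k).comp hinner
  simp only [hXmean, mul_zero, sub_zero] at hclt
  simpa only [inner_smul_right, inner_sum] using hclt

end Convergence

section LinearSystem

variable {ι : Type*} [Fintype ι] [DecidableEq ι]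

theorem aestronglyMeasurable_matrix_inv {Ω : Type*} [MeasurableSpace Ω] {μ : Measure Ω}
    {A : Ω → Matrix ι ι ℝ} (hA : AEStronglyMeasurable A μ) :
    AEStronglyMeasurable (fun ω => (A ω)⁻¹) μ := by
  simp_rw [Matrix.inv_def, Ring.inverse_eq_inv']
  exact (continuous_id.matrix_det.comp_aestronglyMeasurable hA).inv₀.smul
    (continuous_id.matrix_adjugate.comp_aestronglyMeasurable hA)

theorem tendsto_matrix_inv {β : Type*} {l : Filter β} {A : β → Matrix ι ι ℝ} {H : Matrix ι ι ℝ}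
    (hA : Tendsto A l (𝓝 H)) (hH : IsUnit H.det) : Tendsto (fun b => (A b)⁻¹) l (𝓝 H⁻¹) := by
  refine Tendsto.comp (continuousAt_matrix_inv H ?_) hA
  rw [Ring.inverse_eq_inv']
  exact continuousAt_inv₀ hH.ne_zero

theorem eventually_isUnit_det {β : Type*} {l : Filter β} {A : β → Matrix ι ι ℝ}
    {H : Matrix ι ι ℝ} (hA : Tendsto A l (𝓝 H)) (hH : IsUnit H.det) :
    ∀ᶠ b in l, IsUnit (A b).det := by
  filter_upwards [((continuous_id.matrix_det.tendsto H).comp hA).eventually_ne hH.ne_zero] with b hb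
  exact hb.isUnit

theorem tendsto_zero_of_mulVec_eq {β : Type*} {l : Filter β} {A : β → Matrix ι ι ℝ}
    {H : Matrix ι ι ℝ} {δ u : β → EuclideanSpace ℝ ι} (hA : Tendsto A l (𝓝 H))
    (hH : IsUnit H.det) (hu : Tendsto u l (𝓝 0))
    (hδ : ∀ b, IsUnit (A b).det → A b *ᵥ δ b = u b) : Tendsto δ l (𝓝 0) := by
  have hcont : Continuous fun z : Matrix ι ι ℝ × EuclideanSpace ℝ ι =>
      (WithLp.toLp 2 (z.1 *ᵥ z.2) : EuclideanSpace ℝ ι) := by fun_prop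
  have hlim := (hcont.tendsto (H⁻¹, 0)).comp ((tendsto_matrix_inv hA hH).prodMk_nhds hu)
  rw [WithLp.ofLp_zero, Matrix.mulVec_zero, WithLp.toLp_zero] at hlim
  refine hlim.congr' ?_
  filter_upwards [eventually_isUnit_det hA hH] with b hb
  simp [← hδ b hb, Matrix.nonsing_inv_mul _ hb]

theorem tendstoInDistribution_smul_of_mulVec_eq {Ω Ω' : Type*} [MeasurableSpace Ω]
    [MeasurableSpace Ω'] {μ : Measure Ω} {μ' : Measure Ω'} [IsProbabilityMeasure μ]
    [IsProbabilityMeasure μ'] {A : ℕ → Ω → Matrix ι ι ℝ} {H : Matrix ι ι ℝ}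
    {δ u : ℕ → Ω → EuclideanSpace ℝ ι} {Y : Ω' → EuclideanSpace ℝ ι} {c : ℕ → ℝ}
    (hAm : ∀ n, AEStronglyMeasurable (A n) μ) (hδm : ∀ n, AEMeasurable (δ n) μ)
    (hA : ∀ᵐ ω ∂μ, Tendsto (fun n => A n ω) atTop (𝓝 H)) (hH : IsUnit H.det)
    (hδ : ∀ n ω, IsUnit (A n ω).det → A n ω *ᵥ δ n ω = u n ω)
    (hu : TendstoInDistribution (fun n ω => c n • u n ω) atTop
      (fun ω => Matrix.toEuclideanCLM (𝕜 := ℝ) H (Y ω)) (fun _ => μ) μ') :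
    TendstoInDistribution (fun n ω => c n • δ n ω) atTop Y (fun _ => μ) μ' := by
  let toCLM : Matrix ι ι ℝ ≃⋆ₐ[ℝ] (EuclideanSpace ℝ ι →L[ℝ] EuclideanSpace ℝ ι) :=
    Matrix.toEuclideanCLM
  have htoCLM : Continuous toCLM :=
    LinearMap.continuous_of_finiteDimensional toCLM.toAlgEquiv.toLinearMap
  have hBm : ∀ n, AEStronglyMeasurable (fun ω => toCLM (A n ω)⁻¹) μ := fun n =>
    htoCLM.comp_aestronglyMeasurable (aestronglyMeasurable_matrix_inv (hAm n))
  have hB : TendstoInMeasure μ (fun n ω => toCLM (A n ω)⁻¹) atTop fun _ => toCLM H⁻¹ := by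
    refine tendstoInMeasure_of_tendsto_ae hBm ?_
    filter_upwards [hA] with ω hω using (htoCLM.tendsto _).comp (tendsto_matrix_inv hω hH)
  have hslutsky := hu.continuous_comp_prodMk_of_tendstoInMeasure_const
    (g := fun z : EuclideanSpace ℝ ι × (EuclideanSpace ℝ ι →L[ℝ] EuclideanSpace ℝ ι) => z.2 z.1)
    (by fun_prop) hB fun n => (hBm n).aemeasurable
  have hY : ∀ ω, toCLM H⁻¹ (toCLM H (Y ω)) = Y ω := fun ω => by
    ext j
    simp [toCLM, Matrix.nonsing_inv_mul _ hH]
  have hlim : TendstoInDistribution (fun n ω => toCLM (A n ω)⁻¹ (c n • u n ω)) atTop Y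
      (fun _ => μ) μ' := hslutsky.congr (fun _ => .rfl) (.of_forall hY)
  refine tendstoInDistribution_of_tendstoInMeasure_sub _ _ hlim ?_ fun n => (hδm n).fun_const_smul _
  refine tendstoInMeasure_of_tendsto_ae (fun n => AEMeasurable.aestronglyMeasurable
    (((hδm n).fun_const_smul _).sub (hlim.forall_aemeasurable n))) ?_
  filter_upwards [hA] with ω hω
  refine tendsto_const_nhds.congr' ?_
  filter_upwards [eventually_isUnit_det hω hH] with n hn
  ext j
  simp [toCLM, ← hδ n ω hn, Matrix.nonsing_inv_mul _ hn]

end LinearSystem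

section SecondMoment

variable {Ω Ω' ι κ : Type*} [MeasurableSpace Ω] [MeasurableSpace Ω'] {μ : Measure Ω}
  {f g : Ω → ι → ℝ} {M N : Matrix ι ι ℝ}

/-- The random vector `f` is square-integrable with second moment matrix `E[f fᵀ] = M`. -/
structure HasSecondMoment (f : Ω → ι → ℝ) (M : Matrix ι ι ℝ) (μ : Measure Ω) : Prop where
  memLp (a : ι) : MemLp (fun ω => f ω a) 2 μ
  integral_mul (a b : ι) : ∫ ω, f ω a * f ω b ∂μ = M a b

theorem HasSecondMoment.comp_hasLaw {ν : Measure Ω'} {X : Ω' → Ω} (hf : HasSecondMoment f M μ)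
    (hX : HasLaw X μ ν) : HasSecondMoment (fun ω => f (X ω)) M ν where
  memLp a := (hX.map_eq.symm ▸ hf.memLp a).comp_of_map hX.aemeasurable
  integral_mul a b := (hX.integral_comp
    ((hf.memLp a).integrable_mul (hf.memLp b)).aestronglyMeasurable).trans (hf.integral_mul a b)

theorem HasSecondMoment.add (hf : HasSecondMoment f M μ) (hg : HasSecondMoment g N μ)
    (hfg : ∀ a b, ∫ ω, f ω a * g ω b ∂μ = 0) :
    HasSecondMoment (fun ω => f ω + g ω) (M + N) μ where
  memLp a := (hf.memLp a).add (hg.memLp a)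
  integral_mul a b := by
    have hff : Integrable (fun ω => f ω a * f ω b) μ := (hf.memLp a).integrable_mul (hf.memLp b)
    have hfg' : Integrable (fun ω => f ω a * g ω b) μ := (hf.memLp a).integrable_mul (hg.memLp b)
    have hgf : Integrable (fun ω => g ω a * f ω b) μ := (hg.memLp a).integrable_mul (hf.memLp b)
    have hgg : Integrable (fun ω => g ω a * g ω b) μ := (hg.memLp a).integrable_mul (hg.memLp b)
    have hgf0 : ∫ ω, g ω a * f ω b ∂μ = 0 := by simpa only [mul_comm] using hfg b a
    simp only [Pi.add_apply, add_mul, mul_add, Matrix.add_apply]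
    rw [integral_add (by fun_prop) (by fun_prop), integral_add (by fun_prop) (by fun_prop),
      integral_add (by fun_prop) (by fun_prop), hf.integral_mul, hg.integral_mul, hfg, hgf0,
      add_zero, zero_add]

theorem HasSecondMoment.sum {n : Type*} [Fintype n] {f : n → Ω → ι → ℝ} {M : n → Matrix ι ι ℝ}
    (hf : ∀ i, HasSecondMoment (f i) (M i) μ)
    (hcross : ∀ i j, i ≠ j → ∀ a b, ∫ ω, f i ω a * f j ω b ∂μ = 0) :
    HasSecondMoment (fun ω => ∑ i, f i ω) (∑ i, M i) μ where
  memLp a := by simpa only [Finset.sum_apply] using memLp_finsetSum _ fun i _ => (hf i).memLp a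
  integral_mul a b := by
    have hint : ∀ i j, Integrable (fun ω => f i ω a * f j ω b) μ := fun i j =>
      ((hf i).memLp a).integrable_mul ((hf j).memLp b)
    simp only [Finset.sum_apply, Finset.sum_mul_sum, Matrix.sum_apply]
    rw [integral_finsetSum _ fun i _ => integrable_finsetSum _ fun j _ => hint i j]
    refine Finset.sum_congr rfl fun i _ => ?_
    rw [integral_finsetSum _ fun j _ => hint i j, Finset.sum_eq_single i
      (fun j _ hj => hcross i j hj.symm a b) (by simp), (hf i).integral_mul]

theorem HasSecondMoment.add_noise_smul [SFinite μ] {ν : Measure ℝ} [IsProbabilityMeasure ν]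
    {s : ℝ} (hf : HasSecondMoment f M μ) (hg : HasSecondMoment g N μ) (hν : MemLp id 2 ν)
    (hν_mean : ∫ e, e ∂ν = 0) (hν_sq : ∫ e, e ^ 2 ∂ν = s) :
    HasSecondMoment (fun w : Ω × ℝ => f w.1 + w.2 • g w.1) (M + s • N) (μ.prod ν) := by
  refine HasSecondMoment.add ⟨fun a => (hf.memLp a).comp_fst ν, fun a b => ?_⟩
    ⟨fun a => ?_, fun a b => ?_⟩ fun a b => ?_
  · simpa [hf.integral_mul] using integral_prod_mul (μ := μ) (ν := ν) (fun ω => f ω a * f ω b) 1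
  · have hsq : Integrable (fun w : Ω × ℝ => w.2 ^ 2 * g w.1 a ^ 2) (μ.prod ν) := by
      simpa only [id, mul_comm] using (hg.memLp a).integrable_sq.mul_prod hν.integrable_sq
    refine (memLp_two_iff_integrable_sq
      (measurable_snd.aestronglyMeasurable.mul (hg.memLp a).1.comp_fst)).2 ?_
    simpa only [Pi.mul_apply, mul_pow] using hsq
  · have h := integral_prod_mul (μ := μ) (ν := ν) (fun ω => g ω a * g ω b) fun e => e ^ 2
    rw [hg.integral_mul, hν_sq] at h
    rw [Matrix.smul_apply, smul_eq_mul, mul_comm s, ← h]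
    congr with w
    simp only [Pi.smul_apply, smul_eq_mul]
    ring
  · have h := integral_prod_mul (μ := μ) (ν := ν) (fun ω => f ω a * g ω b) fun e => e
    rw [hν_mean, mul_zero] at h
    rw [← h]
    congr with w
    simp only [Pi.smul_apply, smul_eq_mul]
    ring

section Fintype

variable [Fintype ι]

theorem memLp_dotProduct {s : ENNReal} (hf : ∀ a, MemLp (fun ω => f ω a) s μ) (v : ι → ℝ) :
    MemLp (fun ω => v ⬝ᵥ f ω) s μ :=
  memLp_finsetSum _ fun a _ => (hf a).const_mul (v a)

theorem HasSecondMoment.integral_dotProduct_mul_dotProduct (hf : HasSecondMoment f M μ)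
    (v w : ι → ℝ) : ∫ ω, (v ⬝ᵥ f ω) * (w ⬝ᵥ f ω) ∂μ = v ⬝ᵥ M *ᵥ w := by
  have hint : ∀ a b, Integrable (fun ω => v a * w b * (f ω a * f ω b)) μ := fun a b =>
    ((hf.memLp a).integrable_mul (hf.memLp b)).const_mul _
  have hexp : ∀ ω, (v ⬝ᵥ f ω) * (w ⬝ᵥ f ω) = ∑ a, ∑ b, v a * w b * (f ω a * f ω b) := fun ω => by
    simp only [dotProduct, Finset.sum_mul_sum, mul_mul_mul_comm]
  have hquad : v ⬝ᵥ M *ᵥ w = ∑ a, ∑ b, v a * w b * M a b := by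
    simp only [dotProduct, Matrix.mulVec, Finset.mul_sum, mul_assoc, mul_comm (w _)]
  simp_rw [hexp]
  rw [hquad, integral_finsetSum _ fun a _ => integrable_finsetSum _ fun b _ => hint a b]
  simp_rw [integral_finsetSum _ fun b _ => hint _ b, integral_const_mul, hf.integral_mul]

theorem HasSecondMoment.mulVec (hf : HasSecondMoment f M μ) (A : Matrix κ ι ℝ) :
    HasSecondMoment (fun ω => A *ᵥ f ω) (A * M * Aᵀ) μ where
  memLp a := memLp_dotProduct hf.memLp (A a)
  integral_mul a b := by
    refine (hf.integral_dotProduct_mul_dotProduct (A a) (A b)).trans ?_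
    rw [Matrix.mul_assoc]
    simp only [Matrix.mul_apply, dotProduct, Matrix.mulVec, Matrix.transpose_apply]

theorem HasSecondMoment.variance_inner {X : Ω → EuclideanSpace ℝ ι}
    (hX : HasSecondMoment (fun ω => X ω) M μ) (t : EuclideanSpace ℝ ι)
    (hmean : ∫ ω, inner ℝ t (X ω) ∂μ = 0) :
    Var[fun ω => inner ℝ t (X ω); μ] = t ⬝ᵥ M *ᵥ t := by
  simp only [EuclideanSpace.inner_eq_star_dotProduct, star_trivial, dotProduct_comm _ t.ofLp]
    at hmean ⊢
  rw [variance_of_integral_eq_zero (memLp_dotProduct hX.memLp t).1.aemeasurable hmean,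
    ← hX.integral_dotProduct_mul_dotProduct]
  simp only [sq]

end Fintype

theorem HasSecondMoment.posSemidef [Finite ι] (hf : HasSecondMoment f M μ) : M.PosSemidef := by
  have := Fintype.ofFinite ι
  refine .of_dotProduct_mulVec_nonneg ?_ fun v => ?_
  · ext a b
    simp only [Matrix.conjTranspose_apply, star_trivial, ← hf.integral_mul, mul_comm]
  · rw [star_trivial, ← hf.integral_dotProduct_mul_dotProduct]
    exact integral_nonneg fun ω => mul_self_nonneg _

theorem HasSecondMoment.of_covariance_eq [Fintype ι] {P : Measure (EuclideanSpace ℝ ι)}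
    [IsProbabilityMeasure P] (hP : MemLp id 2 P) (hmean : ∫ x, x ∂P = 0)
    (hcov : ∀ j k, cov[fun x => x j, fun x => x k; P] = M j k) :
    HasSecondMoment (fun x : EuclideanSpace ℝ ι => x.ofLp) M P := by
  have hcoord : ∀ j, MemLp (fun x : EuclideanSpace ℝ ι => x j) 2 P := hP.eval_piLp
  refine ⟨hcoord, fun j k => ?_⟩
  have hmean_j : ∫ x : EuclideanSpace ℝ ι, x j ∂P = 0 := by
    rw [← eval_integral_piLp fun l => (hcoord l).integrable one_le_two, hmean, PiLp.zero_apply]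
  rw [← hcov, covariance_eq_sub (hcoord j) (hcoord k), hmean_j, zero_mul, sub_zero]
  rfl

theorem hasSecondMoment_multivariateGaussian [Fintype ι] [DecidableEq ι] (hM : M.PosSemidef) :
    HasSecondMoment (fun z : EuclideanSpace ℝ ι => z.ofLp) M (multivariateGaussian 0 M) :=
  .of_covariance_eq IsGaussian.memLp_two_id integral_id_multivariateGaussian
    (covariance_eval_multivariateGaussian hM)

end SecondMoment

section AgentScore

variable {d p q : ℕ} (π : Fin p ⊕ Fin q ≃ Fin d) {S : Matrix (Fin d) (Fin d) ℝ}
  (θ : EuclideanSpace ℝ (Fin d)) {P : Measure (EuclideanSpace ℝ (Fin d))} {ν : Measure ℝ} {σ : ℝ}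

/-- The score `(y - ⟨x₊, T θ⟩) x₊` of the imputed regression at the true parameter, as a function
of the features `x` and the noise `e` of one sample: by `dotProduct_eq_add_residualDir` the label
`y = ⟨x, θ⟩ + e` exceeds `⟨x₊, T θ⟩` by `⟨g, x⟩ + e`. -/
noncomputable def agentScore (S : Matrix (Fin d) (Fin d) ℝ)
    (w : EuclideanSpace ℝ (Fin d) × ℝ) : Fin p → ℝ :=
  (residualDir π θ S ⬝ᵥ w.1) • (viewPlus π *ᵥ w.1) + w.2 • (viewPlus π *ᵥ w.1)

@[fun_prop]
theorem continuous_agentScore : Continuous (agentScore π θ S) := by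
  unfold agentScore
  fun_prop

theorem HasScoreCov.hasSecondMoment (h : HasScoreCov π S θ P) :
    HasSecondMoment (fun x => (residualDir π θ S ⬝ᵥ x.ofLp) • (viewPlus π *ᵥ x.ofLp))
      (Matrix.of fun a b => ∫ x : EuclideanSpace ℝ (Fin d), (viewPlus π *ᵥ x) a *
        ((viewMinus π *ᵥ θ) ⬝ᵥ residual π S x) ^ 2 * (viewPlus π *ᵥ x) b ∂P) P where
  memLp a := by
    have hcont : Continuous fun x : EuclideanSpace ℝ (Fin d) =>
        ((residualDir π θ S ⬝ᵥ x.ofLp) • (viewPlus π *ᵥ x.ofLp)) a := by fun_prop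
    refine (memLp_two_iff_integrable_sq hcont.aestronglyMeasurable).2
      (h.mono (hcont.pow 2).aestronglyMeasurable (ae_of_all _ fun x => ?_))
    have hnorm : 0 ≤ (viewPlus π *ᵥ x) ⬝ᵥ (viewPlus π *ᵥ x) :=
      Finset.sum_nonneg fun i _ => mul_self_nonneg _
    rw [dotProduct_residual, Real.norm_of_nonneg (sq_nonneg _),
      Real.norm_of_nonneg (mul_nonneg hnorm (sq_nonneg _)), Pi.smul_apply, smul_eq_mul, mul_pow,
      mul_comm, sq ((viewPlus π *ᵥ x) a)]
    exact mul_le_mul_of_nonneg_right (Finset.single_le_sum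
      (f := fun a => (viewPlus π *ᵥ x) a * (viewPlus π *ᵥ x) a)
      (fun i _ => mul_self_nonneg _) (Finset.mem_univ a)) (sq_nonneg _)
  integral_mul a b := by
    simp only [Matrix.of_apply, dotProduct_residual, Pi.smul_apply, smul_eq_mul]
    congr with x
    ring

theorem hasSecondMoment_agentScore [SFinite P] [IsProbabilityMeasure ν]
    (hP : HasSecondMoment (fun x : EuclideanSpace ℝ (Fin d) => x.ofLp) S P)
    (hν : MemLp id 2 ν) (hν_mean : ∫ e, e ∂ν = 0) (hν_sq : ∫ e, e ^ 2 ∂ν = σ ^ 2)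
    (hQ : HasScoreCov π S θ P) :
    HasSecondMoment (agentScore π θ S) (scoreCov π S σ θ P) (P.prod ν) :=
  hQ.hasSecondMoment.add_noise_smul (hP.mulVec (viewPlus π)) hν hν_mean hν_sq

theorem integrable_agentScore [IsFiniteMeasure P] [IsProbabilityMeasure ν]
    (hP : HasSecondMoment (fun x : EuclideanSpace ℝ (Fin d) => x.ofLp) S P) (hν : MemLp id 2 ν) :
    Integrable (agentScore π θ S) (P.prod ν) := by
  refine .of_eval fun a => ?_
  have hobs := memLp_dotProduct hP.memLp (viewPlus π a)
  have hres := (memLp_dotProduct hP.memLp (residualDir π θ S)).integrable_mul hobs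
  have hnoise := (hobs.integrable one_le_two).mul_prod (hν.integrable one_le_two)
  refine ((hres.comp_fst ν).add hnoise).congr (ae_of_all _ fun w => ?_)
  simp only [agentScore, Pi.add_apply, Pi.mul_apply, Pi.smul_apply, smul_eq_mul, id, mul_comm w.2,
    Matrix.mulVec]

/-- The regression part of the score is centred because the residual direction is uncorrelated
with `x₊`, the noise part because the noise is independent of `x`. -/
theorem integral_agentScore [IsProbabilityMeasure P] [IsProbabilityMeasure ν] (hS : S.PosDef)
    (hP : HasSecondMoment (fun x : EuclideanSpace ℝ (Fin d) => x.ofLp) S P)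
    (hν : MemLp id 2 ν) (hν_mean : ∫ e, e ∂ν = 0) :
    ∫ w, agentScore π θ S w ∂P.prod ν = 0 := by
  ext a
  have hobs := memLp_dotProduct hP.memLp (viewPlus π a)
  have hres := (hobs.integrable_mul (memLp_dotProduct hP.memLp (residualDir π θ S))).comp_fst ν
  have hnoise := (hobs.integrable one_le_two).mul_prod (hν.integrable one_le_two)
  have hres_zero : ∫ w : EuclideanSpace ℝ (Fin d) × ℝ,
      (viewPlus π a ⬝ᵥ w.1.ofLp) * (residualDir π θ S ⬝ᵥ w.1.ofLp) ∂P.prod ν = 0 := by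
    rw [integral_fun_fst (fun x : EuclideanSpace ℝ (Fin d) =>
      (viewPlus π a ⬝ᵥ x.ofLp) * (residualDir π θ S ⬝ᵥ x.ofLp)),
      hP.integral_dotProduct_mul_dotProduct, probReal_univ, one_smul]
    exact congrFun (viewPlus_mulVec_mulVec_residualDir π θ hS) a
  have hnoise_zero : ∫ w : EuclideanSpace ℝ (Fin d) × ℝ,
      (viewPlus π a ⬝ᵥ w.1.ofLp) * w.2 ∂P.prod ν = 0 :=
    (integral_prod_mul (fun x : EuclideanSpace ℝ (Fin d) => viewPlus π a ⬝ᵥ x.ofLp)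
      fun e => e).trans (by rw [hν_mean, mul_zero])
  rw [eval_integral fun b => (integrable_agentScore π θ hP hν).eval b]
  calc ∫ w, agentScore π θ S w a ∂P.prod ν
      = ∫ w : EuclideanSpace ℝ (Fin d) × ℝ,
          (viewPlus π a ⬝ᵥ w.1.ofLp) * (residualDir π θ S ⬝ᵥ w.1.ofLp) +
            (viewPlus π a ⬝ᵥ w.1.ofLp) * w.2 ∂P.prod ν := by
        simp only [agentScore, Pi.add_apply, Pi.smul_apply, smul_eq_mul, mul_comm, Matrix.mulVec]
    _ = 0 + 0 := (integral_add hres hnoise).trans (congrArg₂ (· + ·) hres_zero hnoise_zero)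
    _ = 0 := add_zero 0

end AgentScore

section SampleScore

variable {m d : ℕ} {r : Fin m → ℕ} (π : ∀ i, Fin (r i) ⊕ Fin (d - r i) ≃ Fin d)
  {S : Matrix (Fin d) (Fin d) ℝ} (θ : EuclideanSpace ℝ (Fin d)) (α : Fin m → ℝ)
  {P : Measure (EuclideanSpace ℝ (Fin d))} [IsProbabilityMeasure P]
  {ν : Measure ℝ} [IsProbabilityMeasure ν] {σ : ℝ}

/-- The total score `∑ᵢ αᵢ Tᵢᵀ sᵢ` of one sample per agent, where `sᵢ` is the score of
agent `i`. -/
noncomputable def sampleScore (S : Matrix (Fin d) (Fin d) ℝ)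
    (w : Fin m → EuclideanSpace ℝ (Fin d) × ℝ) : EuclideanSpace ℝ (Fin d) :=
  WithLp.toLp 2 (∑ i, (α i • (imputeMat (π i) S)ᵀ) *ᵥ agentScore (π i) θ S (w i))

@[fun_prop]
theorem continuous_sampleScore : Continuous (sampleScore π θ α S) := by
  unfold sampleScore
  fun_prop

theorem integrable_mulVec_agentScore
    (hP : HasSecondMoment (fun x : EuclideanSpace ℝ (Fin d) => x.ofLp) S P) (hν : MemLp id 2 ν)
    (i : Fin m) : Integrable (fun w : Fin m → EuclideanSpace ℝ (Fin d) × ℝ =>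
      (α i • (imputeMat (π i) S)ᵀ) *ᵥ agentScore (π i) θ S (w i))
      (Measure.pi fun _ => P.prod ν) :=
  integrable_comp_eval (μ := fun _ => P.prod ν)
    ((α i • (imputeMat (π i) S)ᵀ).mulVecLin.toContinuousLinearMap.integrable_comp
      (integrable_agentScore (π i) θ hP hν))

theorem integral_mulVec_agentScore (hS : S.PosDef)
    (hP : HasSecondMoment (fun x : EuclideanSpace ℝ (Fin d) => x.ofLp) S P)
    (hν : MemLp id 2 ν) (hν_mean : ∫ e, e ∂ν = 0) (i : Fin m) :
    ∫ w : Fin m → EuclideanSpace ℝ (Fin d) × ℝ,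
      (α i • (imputeMat (π i) S)ᵀ) *ᵥ agentScore (π i) θ S (w i)
      ∂(Measure.pi fun _ => P.prod ν) = 0 := by
  have hL := (α i • (imputeMat (π i) S)ᵀ).mulVecLin.toContinuousLinearMap.integral_comp_comm
    (integrable_agentScore (π i) θ hP hν)
  rw [integral_agentScore (π i) θ hS hP hν hν_mean, map_zero] at hL
  exact (integral_comp_eval (μ := fun _ => P.prod ν) (i := i)
    (f := fun w => (α i • (imputeMat (π i) S)ᵀ) *ᵥ agentScore (π i) θ S w)
    (Continuous.aestronglyMeasurable (by fun_prop))).trans hL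

theorem integrable_sampleScore
    (hP : HasSecondMoment (fun x : EuclideanSpace ℝ (Fin d) => x.ofLp) S P)
    (hν : MemLp id 2 ν) :
    Integrable (sampleScore π θ α S) (Measure.pi fun _ => P.prod ν) :=
  (PiLp.continuousLinearEquiv 2 ℝ fun _ : Fin d => ℝ).symm.toContinuousLinearMap.integrable_comp
    (integrable_finsetSum _ fun i _ => integrable_mulVec_agentScore π θ α hP hν i)

theorem integral_sampleScore (hS : S.PosDef)
    (hP : HasSecondMoment (fun x : EuclideanSpace ℝ (Fin d) => x.ofLp) S P)
    (hν : MemLp id 2 ν) (hν_mean : ∫ e, e ∂ν = 0) :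
    ∫ w, sampleScore π θ α S w ∂(Measure.pi fun _ => P.prod ν) = 0 := by
  refine ((PiLp.continuousLinearEquiv 2 ℝ fun _ : Fin d => ℝ).symm.integral_comp_comm _).trans ?_
  rw [integral_finsetSum _ fun i _ => integrable_mulVec_agentScore π θ α hP hν i]
  simp only [integral_mulVec_agentScore π θ α hS hP hν hν_mean, Finset.sum_const_zero, map_zero]

theorem hasSecondMoment_sampleScore (hS : S.PosDef)
    (hP : HasSecondMoment (fun x : EuclideanSpace ℝ (Fin d) => x.ofLp) S P)
    (hν : MemLp id 2 ν) (hν_mean : ∫ e, e ∂ν = 0) (hν_sq : ∫ e, e ^ 2 ∂ν = σ ^ 2)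
    (hQ : ∀ i, HasScoreCov (π i) S θ P) :
    HasSecondMoment (fun w => (sampleScore π θ α S w).ofLp)
      (∑ i, α i ^ 2 • ((imputeMat (π i) S)ᵀ * scoreCov (π i) S σ θ P * imputeMat (π i) S))
      (Measure.pi fun _ => P.prod ν) := by
  let s (i : Fin m) (w : EuclideanSpace ℝ (Fin d) × ℝ) : Fin d → ℝ :=
    (α i • (imputeMat (π i) S)ᵀ) *ᵥ agentScore (π i) θ S w
  have hs : ∀ i a, Continuous fun w => s i w a := fun i a => by fun_prop
  have hs_zero : ∀ i a, ∫ w : Fin m → EuclideanSpace ℝ (Fin d) × ℝ, s i (w i) a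
      ∂(Measure.pi fun _ => P.prod ν) = 0 := fun i a => by
    rw [← eval_integral fun b => (integrable_mulVec_agentScore π θ α hP hν i).eval b,
      integral_mulVec_agentScore π θ α hS hP hν hν_mean, Pi.zero_apply]
  have hindep := iIndepFun_pi (μ := fun _ : Fin m => P.prod ν) fun _ => aemeasurable_id
  have hsum : HasSecondMoment (fun w : Fin m → EuclideanSpace ℝ (Fin d) × ℝ => ∑ i, s i (w i))
      (∑ i, (α i • (imputeMat (π i) S)ᵀ) * scoreCov (π i) S σ θ P *
        (α i • (imputeMat (π i) S)ᵀ)ᵀ) (Measure.pi fun _ => P.prod ν) := by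
    refine .sum (fun i => ((hasSecondMoment_agentScore (π i) θ hP hν hν_mean hν_sq
      (hQ i)).mulVec _).comp_hasLaw
      (measurePreserving_eval (fun _ => P.prod ν) i).hasLaw) fun i j hij a b => ?_
    refine (((hindep.indepFun hij).comp (hs i a).measurable
      (hs j b).measurable).integral_fun_mul_eq_mul_integral ?_ ?_).trans ?_
    · exact ((hs i a).comp (continuous_apply i)).aestronglyMeasurable
    · exact ((hs j b).comp (continuous_apply j)).aestronglyMeasurable
    · simp only [Function.comp_def, id, hs_zero, mul_zero]
  simpa [sampleScore, s, smul_smul, sq] using hsum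

end SampleScore

section NormalEquations

variable {d : ℕ} {S : Matrix (Fin d) (Fin d) ℝ} (θ : EuclideanSpace ℝ (Fin d))

theorem designMat_mul_transpose_viewPlus_apply {p q : ℕ} (π : Fin p ⊕ Fin q ≃ Fin d) (n : ℕ)
    (x : ℕ → EuclideanSpace ℝ (Fin d)) (k : Fin n) (a : Fin p) :
    (designMat n x * (viewPlus π)ᵀ) k a = (viewPlus π *ᵥ x k) a := by
  simp [designMat, Matrix.mul_apply, Matrix.mulVec, dotProduct, mul_comm]

theorem transpose_observed_mulVec_sub {p q : ℕ} (π : Fin p ⊕ Fin q ≃ Fin d)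
    (hS : S.IsHermitian) (n : ℕ) (x : ℕ → EuclideanSpace ℝ (Fin d)) (ε : ℕ → ℝ) :
    (designMat n x * (viewPlus π)ᵀ)ᵀ *ᵥ (designMat n x *ᵥ θ + (fun k : Fin n => ε k) -
        (designMat n x * (viewPlus π)ᵀ) *ᵥ (imputeMat π S *ᵥ θ))
      = ∑ k ∈ Finset.range n, agentScore π θ S (x k, ε k) := by
  ext a
  rw [Finset.sum_apply, Finset.sum_range, Matrix.mulVec, dotProduct]
  refine Finset.sum_congr rfl fun k _ => ?_
  have hobs : (designMat n x * (viewPlus π)ᵀ) k = viewPlus π *ᵥ x k :=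
    funext (designMat_mul_transpose_viewPlus_apply π n x k)
  have hres : (designMat n x *ᵥ θ + (fun k : Fin n => ε k) -
      (designMat n x * (viewPlus π)ᵀ) *ᵥ (imputeMat π S *ᵥ θ)) k
      = residualDir π θ S ⬝ᵥ x k + ε k := by
    change (x k).ofLp ⬝ᵥ θ + ε k - (designMat n x * (viewPlus π)ᵀ) k ⬝ᵥ (imputeMat π S *ᵥ θ) = _
    rw [dotProduct_eq_add_residualDir π θ hS, hobs]
    ring
  rw [Matrix.transpose_apply, hres, hobs, agentScore, Pi.add_apply, Pi.smul_apply, Pi.smul_apply,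
    smul_eq_mul, smul_eq_mul, ← add_mul, mul_comm]

variable {m : ℕ} {r : Fin m → ℕ} (π : ∀ i, Fin (r i) ⊕ Fin (d - r i) ≃ Fin d) (α : Fin m → ℝ)

/-- The matrix of the normal equations of the estimator after `n` samples per agent, divided by
`n` in order to converge. -/
noncomputable def empiricalGram (S : Matrix (Fin d) (Fin d) ℝ) (n : ℕ)
    (x : Fin m → ℕ → EuclideanSpace ℝ (Fin d)) : Matrix (Fin d) (Fin d) ℝ :=
  imputedGram π S α ((n : ℝ)⁻¹ • fun i => (designMat n (x i))ᵀ * designMat n (x i))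

theorem sum_transpose_mul_observed (n : ℕ) (x : Fin m → ℕ → EuclideanSpace ℝ (Fin d)) :
    ∑ i, α i • ((imputeMat (π i) S)ᵀ * (designMat n (x i) * (viewPlus (π i))ᵀ)ᵀ *
        (designMat n (x i) * (viewPlus (π i))ᵀ) * imputeMat (π i) S)
      = imputedGram π S α fun i => (designMat n (x i))ᵀ * designMat n (x i) := by
  simp [imputedGram, blockPlus, Matrix.mul_assoc]

theorem sum_transpose_mulVec_label (hS : S.IsHermitian) (n : ℕ)
    (x : Fin m → ℕ → EuclideanSpace ℝ (Fin d)) (ε : Fin m → ℕ → ℝ) :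
    ∑ i, α i • (((imputeMat (π i) S)ᵀ * (designMat n (x i) * (viewPlus (π i))ᵀ)ᵀ) *ᵥ
        (designMat n (x i) *ᵥ θ + fun k : Fin n => ε i k))
      = imputedGram π S α (fun i => (designMat n (x i))ᵀ * designMat n (x i)) *ᵥ θ +
        (∑ k ∈ Finset.range n, sampleScore π θ α S fun i => (x i k, ε i k)).ofLp := by
  have hscore : (∑ k ∈ Finset.range n, sampleScore π θ α S fun i => (x i k, ε i k)).ofLp
      = ∑ i, α i • ((imputeMat (π i) S)ᵀ *ᵥ
        ∑ k ∈ Finset.range n, agentScore (π i) θ S (x i k, ε i k)) := by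
    simp only [sampleScore, WithLp.ofLp_sum, Matrix.mulVec_sum, Finset.smul_sum, Matrix.smul_mulVec]
    exact Finset.sum_comm
  rw [hscore, ← sum_transpose_mul_observed, Matrix.sum_mulVec, ← Finset.sum_add_distrib]
  refine Finset.sum_congr rfl fun i _ => ?_
  rw [Matrix.smul_mulVec, ← smul_add, ← transpose_observed_mulVec_sub θ (π i) hS]
  simp only [Matrix.mulVec_sub, Matrix.mulVec_mulVec, Matrix.mul_assoc]
  rw [add_sub_cancel]

theorem impGlbEstimator_eq (hS : S.IsHermitian) (n : ℕ)
    (x : Fin m → ℕ → EuclideanSpace ℝ (Fin d)) (ε : Fin m → ℕ → ℝ) :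
    impGlbEstimator π S θ α n x ε = WithLp.toLp 2
      ((imputedGram π S α fun i => (designMat n (x i))ᵀ * designMat n (x i))⁻¹ *ᵥ
        (imputedGram π S α (fun i => (designMat n (x i))ᵀ * designMat n (x i)) *ᵥ θ +
          (∑ k ∈ Finset.range n, sampleScore π θ α S fun i => (x i k, ε i k)).ofLp)) :=
  congrArg₂ (fun G b => WithLp.toLp 2 (G⁻¹ *ᵥ b)) (sum_transpose_mul_observed π α n x)
    (sum_transpose_mulVec_label θ π α hS n x ε)

theorem empiricalGram_mulVec_impGlbEstimator_sub (hS : S.IsHermitian) (n : ℕ)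
    (x : Fin m → ℕ → EuclideanSpace ℝ (Fin d)) (ε : Fin m → ℕ → ℝ)
    (hdet : IsUnit (empiricalGram π α S n x).det) :
    empiricalGram π α S n x *ᵥ (impGlbEstimator π S θ α n x ε - θ)
      = ((n : ℝ)⁻¹ • ∑ k ∈ Finset.range n, sampleScore π θ α S fun i => (x i k, ε i k) :
        EuclideanSpace ℝ (Fin d)) := by
  rw [empiricalGram, imputedGram_smul] at hdet ⊢
  rcases eq_or_ne (n : ℝ)⁻¹ 0 with hn | hn
  · simp [hn]
  have hunit : IsUnit (imputedGram π S α fun i => (designMat n (x i))ᵀ * designMat n (x i)).det :=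
    isUnit_of_mul_isUnit_right (by rwa [Matrix.det_smul] at hdet)
  rw [impGlbEstimator_eq θ π α hS, Matrix.smul_mulVec, Matrix.mulVec_sub, Matrix.mulVec_mulVec,
    Matrix.mul_nonsing_inv _ hunit, Matrix.one_mulVec, add_sub_cancel_left, WithLp.ofLp_smul]

end NormalEquations

section Independence

variable {ι κ Ω α : Type*} [Countable ι] [Countable κ] [MeasurableSpace Ω] [MeasurableSpace α]
  {P : Measure Ω}

theorem iIndepFun_curry {X : ι × κ → Ω → α} (mX : ∀ p, AEMeasurable (X p) P)
    (h : iIndepFun X P) : iIndepFun (fun i ω (j : κ) => X (i, j) ω) P := by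
  have := h.isProbabilityMeasure
  have hprob (i : ι) (j : κ) : IsProbabilityMeasure (P.map (X (i, j))) :=
    Measure.isProbabilityMeasure_map (mX (i, j))
  have hrow (i : ι) : P.map (fun ω (j : κ) => X (i, j) ω)
      = Measure.infinitePi fun j => P.map (X (i, j)) :=
    (h.precomp (g := fun j : κ => (i, j)) (Prod.mk_right_injective i)).map_fun_eq_infinitePi_map₀'
      fun j => mX (i, j)
  rw [iIndepFun_iff_map_fun_eq_infinitePi_map₀' fun i =>
    aemeasurable_pi_lambda _ fun j => mX (i, j)]
  simp_rw [hrow]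
  rw [← Measure.infinitePi_map_curry (fun i j => P.map (X (i, j))),
    ← h.map_fun_eq_infinitePi_map₀' mX,
    AEMeasurable.map_map_of_aemeasurable (by fun_prop) (aemeasurable_pi_lambda _ mX)]
  rfl

end Independence

section Asymptotics

variable {d : ℕ} {S : Matrix (Fin d) (Fin d) ℝ} {P : Measure (EuclideanSpace ℝ (Fin d))}
  {Ω : Type*} [MeasurableSpace Ω] {μ : Measure Ω}

theorem tendsto_inv_smul_transpose_designMat_mul {x : ℕ → Ω → EuclideanSpace ℝ (Fin d)}
    (hP : HasSecondMoment (fun x : EuclideanSpace ℝ (Fin d) => x.ofLp) S P)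
    (hindep : iIndepFun x μ) (hx : ∀ k, HasLaw (x k) P μ) :
    ∀ᵐ ω ∂μ, Tendsto (fun n : ℕ => (n : ℝ)⁻¹ •
      ((designMat n fun k => x k ω)ᵀ * designMat n fun k => x k ω)) atTop (𝓝 S) := by
  have hmul (j l : Fin d) : Measurable fun v : EuclideanSpace ℝ (Fin d) => v j * v l := by fun_prop
  have hslln (j l : Fin d) : ∀ᵐ ω ∂μ, Tendsto (fun n : ℕ =>
      (n : ℝ)⁻¹ • ∑ k ∈ Finset.range n, x k ω j * x k ω l) atTop (𝓝 (S j l)) := by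
    have hx0 := hP.comp_hasLaw (hx 0)
    rw [← hx0.integral_mul j l]
    exact strong_law_ae (fun k ω => x k ω j * x k ω l) ((hx0.memLp j).integrable_mul (hx0.memLp l))
      (fun k k' hk => (hindep.indepFun hk).comp (hmul j l) (hmul j l))
      fun k => ((hx k).identDistrib (hx 0)).comp (hmul j l)
  filter_upwards [ae_all_iff.2 fun j => ae_all_iff.2 (hslln j)] with ω hω
  refine tendsto_pi_nhds.2 fun j => tendsto_pi_nhds.2 fun l => (hω j l).congr fun n => ?_
  simp [Matrix.mul_apply, designMat, Finset.sum_range]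

variable {m : ℕ} {r : Fin m → ℕ} {π : ∀ i, Fin (r i) ⊕ Fin (d - r i) ≃ Fin d} {α : Fin m → ℝ}
  {θ : EuclideanSpace ℝ (Fin d)} {ν : Measure ℝ} {σ : ℝ}

@[fun_prop]
theorem continuous_designMat (n : ℕ) : Continuous (designMat (d := d) n) := by
  unfold designMat
  exact continuous_matrix fun k j => by fun_prop

@[fun_prop]
theorem continuous_empiricalGram (n : ℕ) : Continuous (empiricalGram π α S n) := by
  unfold empiricalGram
  fun_prop

theorem aestronglyMeasurable_empiricalGram {x : Fin m → ℕ → Ω → EuclideanSpace ℝ (Fin d)}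
    (hx : ∀ i k, AEMeasurable (x i k) μ) (n : ℕ) :
    AEStronglyMeasurable (fun ω => empiricalGram π α S n fun i k => x i k ω) μ := by
  have hX : AEMeasurable (fun ω i k => x i k ω) μ := by fun_prop
  exact (continuous_empiricalGram n).comp_aestronglyMeasurable hX.aestronglyMeasurable

theorem aemeasurable_impGlbEstimator (hS : S.IsHermitian)
    {x : Fin m → ℕ → Ω → EuclideanSpace ℝ (Fin d)} {ε : Fin m → ℕ → Ω → ℝ}
    (hx : ∀ i k, AEMeasurable (x i k) μ) (hε : ∀ i k, AEMeasurable (ε i k) μ) (n : ℕ) :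
    AEMeasurable
      (fun ω => impGlbEstimator π S θ α n (fun i k => x i k ω) fun i k => ε i k ω) μ := by
  have hdata : AEMeasurable (fun ω => (fun i k => x i k ω, fun i k => ε i k ω)) μ := by fun_prop
  have hgram : Continuous fun z : (Fin m → ℕ → EuclideanSpace ℝ (Fin d)) × (Fin m → ℕ → ℝ) =>
      imputedGram π S α fun i => (designMat n (z.1 i))ᵀ * designMat n (z.1 i) := by fun_prop
  have hrhs : Continuous fun z : (Fin m → ℕ → EuclideanSpace ℝ (Fin d)) × (Fin m → ℕ → ℝ) =>
      imputedGram π S α (fun i => (designMat n (z.1 i))ᵀ * designMat n (z.1 i)) *ᵥ θ +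
        (∑ k ∈ Finset.range n, sampleScore π θ α S fun i => (z.1 i k, z.2 i k)).ofLp := by fun_prop
  have hsolve : Continuous fun z : Matrix (Fin d) (Fin d) ℝ × (Fin d → ℝ) =>
      (WithLp.toLp 2 (z.1 *ᵥ z.2) : EuclideanSpace ℝ (Fin d)) := by fun_prop
  simp only [impGlbEstimator_eq θ π α hS]
  exact (hsolve.comp_aestronglyMeasurable ((aestronglyMeasurable_matrix_inv
    (hgram.comp_aestronglyMeasurable hdata.aestronglyMeasurable)).prodMk
    (hrhs.comp_aestronglyMeasurable hdata.aestronglyMeasurable))).aemeasurable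

variable [IsProbabilityMeasure P] [IsProbabilityMeasure ν]
  {W : ℕ → Ω → Fin m → EuclideanSpace ℝ (Fin d) × ℝ}

theorem tendsto_empiricalGram
    (hP : HasSecondMoment (fun x : EuclideanSpace ℝ (Fin d) => x.ofLp) S P)
    (hindep : iIndepFun W μ) (hW : ∀ k, HasLaw (W k) (Measure.pi fun _ => P.prod ν) μ) :
    ∀ᵐ ω ∂μ, Tendsto (fun n => empiricalGram π α S n fun i k => (W k ω i).1) atTop
      (𝓝 (imputedGram π S α fun _ => S)) := by
  have hfeature (i : Fin m) : MeasurePreserving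
      (fun w : Fin m → EuclideanSpace ℝ (Fin d) × ℝ => (w i).1) (Measure.pi fun _ => P.prod ν) P :=
    measurePreserving_fst.comp (measurePreserving_eval (fun _ => P.prod ν) i)
  have hgram (i : Fin m) := tendsto_inv_smul_transpose_designMat_mul
    (x := fun k ω => (W k ω i).1) hP (hindep.comp _ fun _ => (hfeature i).measurable)
    fun k => (hfeature i).hasLaw.comp (hW k)
  filter_upwards [ae_all_iff.2 hgram] with ω hω
  exact ((continuous_imputedGram α).tendsto _).comp (tendsto_pi_nhds.2 hω)

theorem tendsto_inv_smul_sum_sampleScore (hS : S.PosDef)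
    (hP : HasSecondMoment (fun x : EuclideanSpace ℝ (Fin d) => x.ofLp) S P)
    (hν : MemLp id 2 ν) (hν_mean : ∫ e, e ∂ν = 0)
    (hindep : iIndepFun W μ) (hW : ∀ k, HasLaw (W k) (Measure.pi fun _ => P.prod ν) μ) :
    ∀ᵐ ω ∂μ, Tendsto (fun n : ℕ =>
      (n : ℝ)⁻¹ • ∑ k ∈ Finset.range n, sampleScore π θ α S (W k ω)) atTop (𝓝 0) := by
  have hscore : Measurable (sampleScore π θ α S) := (continuous_sampleScore π θ α).measurable
  have hint := integrable_sampleScore π θ α hP hν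
  rw [← integral_sampleScore π θ α hS hP hν hν_mean, ← (hW 0).integral_comp hint.1]
  exact strong_law_ae (fun k ω => sampleScore π θ α S (W k ω))
    (((hW 0).map_eq.symm ▸ hint).comp_aemeasurable (hW 0).aemeasurable)
    (fun k l hkl => (hindep.indepFun hkl).comp hscore hscore)
    fun k => ((hW k).identDistrib (hW 0)).comp hscore

theorem tendsto_impGlbEstimator (hS : S.PosDef)
    (hcover : ∀ j : Fin d, ∃ (i : Fin m) (a : Fin (r i)), π i (Sum.inl a) = j)
    (hα : ∀ i, 0 < α i)
    (hP : HasSecondMoment (fun x : EuclideanSpace ℝ (Fin d) => x.ofLp) S P)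
    (hν : MemLp id 2 ν) (hν_mean : ∫ e, e ∂ν = 0)
    (hindep : iIndepFun W μ) (hW : ∀ k, HasLaw (W k) (Measure.pi fun _ => P.prod ν) μ) :
    ∀ᵐ ω ∂μ, Tendsto (fun n => impGlbEstimator π S θ α n (fun i k => (W k ω i).1)
      fun i k => (W k ω i).2) atTop (𝓝 θ) := by
  filter_upwards [tendsto_empiricalGram (π := π) (α := α) hP hindep hW,
    tendsto_inv_smul_sum_sampleScore (π := π) (α := α) (θ := θ) hS hP hν hν_mean hindep hW]
    with ω hgram hscore
  exact tendsto_sub_nhds_zero_iff.1 (tendsto_zero_of_mulVec_eq hgram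
    (posDef_imputedGram hS hcover hα).det_pos.ne'.isUnit hscore fun n =>
      empiricalGram_mulVec_impGlbEstimator_sub θ π α hS.isHermitian n (fun i k => (W k ω i).1)
        fun i k => (W k ω i).2)

end Asymptotics

section Normality

variable {m d : ℕ} {r : Fin m → ℕ} {π : ∀ i, Fin (r i) ⊕ Fin (d - r i) ≃ Fin d}
  {S : Matrix (Fin d) (Fin d) ℝ} {α : Fin m → ℝ} {θ : EuclideanSpace ℝ (Fin d)}
  {P : Measure (EuclideanSpace ℝ (Fin d))} {σ : ℝ}

theorem posSemidef_impGlbCov (hS : S.PosDef)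
    (hcover : ∀ j : Fin d, ∃ (i : Fin m) (a : Fin (r i)), π i (Sum.inl a) = j)
    (hα : ∀ i, 0 < α i)
    (hM : (∑ i, α i ^ 2 • ((imputeMat (π i) S)ᵀ * scoreCov (π i) S σ θ P *
      imputeMat (π i) S)).PosSemidef) :
    (impGlbCov π S σ θ P α).PosSemidef := by
  have hH := (posDef_imputedGram hS hcover hα).inv.isHermitian
  have h := hM.mul_mul_conjTranspose_same (imputedGram π S α fun _ => S)⁻¹
  rwa [hH.eq] at h

theorem imputedGram_mul_impGlbCov_mul_transpose (hS : S.PosDef)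
    (hcover : ∀ j : Fin d, ∃ (i : Fin m) (a : Fin (r i)), π i (Sum.inl a) = j)
    (hα : ∀ i, 0 < α i) :
    (imputedGram π S α fun _ => S) * impGlbCov π S σ θ P α * (imputedGram π S α fun _ => S)ᵀ
      = ∑ i, α i ^ 2 • ((imputeMat (π i) S)ᵀ * scoreCov (π i) S σ θ P * imputeMat (π i) S) := by
  have hH := posDef_imputedGram hS hcover hα
  have hdet := hH.det_pos.ne'.isUnit
  have hHt : (imputedGram π S α fun _ => S)ᵀ = imputedGram π S α fun _ => S := hH.isHermitian
  rw [hHt, impGlbCov, Matrix.mul_assoc _⁻¹]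
  exact (congrArg (· * _) (Matrix.mul_nonsing_inv_cancel_left _ _ hdet)).trans
    (Matrix.nonsing_inv_mul_cancel_right _ _ hdet)

variable [IsProbabilityMeasure P] {ν : Measure ℝ} [IsProbabilityMeasure ν]
  {Ω Ω' : Type*} [MeasurableSpace Ω] {μ : Measure Ω} [IsProbabilityMeasure μ]
  [MeasurableSpace Ω'] {μ' : Measure Ω'} [IsProbabilityMeasure μ']
  {W : ℕ → Ω → Fin m → EuclideanSpace ℝ (Fin d) × ℝ}

theorem tendstoInDistribution_inv_sqrt_smul_sum_sampleScore (hS : S.PosDef)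
    (hP : HasSecondMoment (fun x : EuclideanSpace ℝ (Fin d) => x.ofLp) S P)
    (hν : MemLp id 2 ν) (hν_mean : ∫ e, e ∂ν = 0) (hν_sq : ∫ e, e ^ 2 ∂ν = σ ^ 2)
    (hQ : ∀ i, HasScoreCov (π i) S θ P)
    (hindep : iIndepFun W μ) (hW : ∀ k, HasLaw (W k) (Measure.pi fun _ => P.prod ν) μ)
    {Y : Ω' → EuclideanSpace ℝ (Fin d)} (hY : HasGaussianLaw Y μ')
    (hY_mean : ∫ ω, Y ω ∂μ' = 0) (hY_cov : HasSecondMoment (fun ω => (Y ω).ofLp)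
      (∑ i, α i ^ 2 • ((imputeMat (π i) S)ᵀ * scoreCov (π i) S σ θ P * imputeMat (π i) S)) μ') :
    TendstoInDistribution
      (fun (n : ℕ) ω => (√(n : ℝ))⁻¹ • ∑ k ∈ Finset.range n, sampleScore π θ α S (W k ω))
      atTop Y (fun _ => μ) μ' := by
  have hscore : Measurable (sampleScore π θ α S) := (continuous_sampleScore π θ α).measurable
  have hint := integrable_sampleScore π θ α hP hν
  have hX := (hasSecondMoment_sampleScore π θ α hS hP hν hν_mean hν_sq hQ).comp_hasLaw (hW 0)
  have hX_mean : ∀ t, ∫ ω, inner ℝ t (sampleScore π θ α S (W 0 ω)) ∂μ = 0 := fun t => by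
    rw [integral_inner (((hW 0).map_eq.symm ▸ hint).comp_aemeasurable (hW 0).aemeasurable)]
    have hmean := (hW 0).integral_comp hint.1
    exact (congrArg (inner ℝ t) (hmean.trans
      (integral_sampleScore π θ α hS hP hν hν_mean))).trans (inner_zero_right t)
  have hY_inner : ∀ t, ∫ ω, inner ℝ t (Y ω) ∂μ' = 0 := fun t => by
    rw [integral_inner hY.integrable, hY_mean, inner_zero_right]
  exact tendstoInDistribution_inv_sqrt_smul_sum
    (hindep.comp (fun _ => sampleScore π θ α S) fun _ => hscore)
    (fun k => ((hW k).identDistrib (hW 0)).comp hscore) (memLp_piLp_iff.2 hX.memLp) hX_mean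
    hY hY_inner fun t => by
      rw [hX.variance_inner t (hX_mean t), hY_cov.variance_inner t (hY_inner t)]

theorem tendstoInDistribution_sqrt_smul_impGlbEstimator_sub (hS : S.PosDef)
    (hcover : ∀ j : Fin d, ∃ (i : Fin m) (a : Fin (r i)), π i (Sum.inl a) = j)
    (hα : ∀ i, 0 < α i)
    (hP : HasSecondMoment (fun x : EuclideanSpace ℝ (Fin d) => x.ofLp) S P)
    (hν : MemLp id 2 ν) (hν_mean : ∫ e, e ∂ν = 0) (hν_sq : ∫ e, e ^ 2 ∂ν = σ ^ 2)
    (hQ : ∀ i, HasScoreCov (π i) S θ P)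
    (hindep : iIndepFun W μ) (hW : ∀ k, HasLaw (W k) (Measure.pi fun _ => P.prod ν) μ) :
    TendstoInDistribution (fun (n : ℕ) ω => √(n : ℝ) •
      (impGlbEstimator π S θ α n (fun i k => (W k ω i).1) (fun i k => (W k ω i).2) - θ))
      atTop id (fun _ => μ) (multivariateGaussian 0 (impGlbCov π S σ θ P α)) := by
  have hM := (hasSecondMoment_sampleScore π θ α hS hP hν hν_mean hν_sq hQ).posSemidef
  have hC := posSemidef_impGlbCov hS hcover hα hM
  have hZ := (hasSecondMoment_multivariateGaussian hC).mulVec (imputedGram π S α fun _ => S)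
  rw [imputedGram_mul_impGlbCov_mul_transpose hS hcover hα] at hZ
  let L := Matrix.toEuclideanCLM (𝕜 := ℝ) (imputedGram π S α fun _ => S)
  have hscore := tendstoInDistribution_inv_sqrt_smul_sum_sampleScore hS hP hν hν_mean hν_sq hQ
    hindep hW (Y := L) (IsGaussian.hasGaussianLaw_id.map_fun L)
    ((L.integral_comp_comm IsGaussian.integrable_id).trans
      ((congrArg L integral_id_multivariateGaussian).trans (map_zero L))) hZ
  have hx : ∀ i k, AEMeasurable (fun ω => (W k ω i).1) μ := fun i k => by
    have := (hW k).aemeasurable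
    fun_prop
  have hε : ∀ i k, AEMeasurable (fun ω => (W k ω i).2) μ := fun i k => by
    have := (hW k).aemeasurable
    fun_prop
  refine tendstoInDistribution_smul_of_mulVec_eq (aestronglyMeasurable_empiricalGram hx)
    (fun n => (aemeasurable_impGlbEstimator hS.isHermitian hx hε n).sub_const θ)
    (tendsto_empiricalGram hP hindep hW)
    (posDef_imputedGram hS hcover hα).det_pos.ne'.isUnit
    (fun n ω => empiricalGram_mulVec_impGlbEstimator_sub θ π α hS.isHermitian n
      (fun i k => (W k ω i).1) fun i k => (W k ω i).2) ?_
  simp only [smul_smul, ← div_eq_mul_inv, Real.sqrt_div_self]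
  exact hscore

end Normality

section Gaussian

variable {d p q : ℕ} (π : Fin p ⊕ Fin q ≃ Fin d) {S : Matrix (Fin d) (Fin d) ℝ}
  (θ : EuclideanSpace ℝ (Fin d)) {P : Measure (EuclideanSpace ℝ (Fin d))} [IsGaussian P]

theorem indepFun_viewPlus_mulVec_residualDir_dotProduct (hS : S.PosDef)
    (hP : HasSecondMoment (fun x : EuclideanSpace ℝ (Fin d) => x.ofLp) S P)
    (hmean : ∫ x, x ∂P = 0) :
    IndepFun (fun x : EuclideanSpace ℝ (Fin d) => viewPlus π *ᵥ x)
      (fun (x : EuclideanSpace ℝ (Fin d)) (_ : Unit) => residualDir π θ S ⬝ᵥ x) P := by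
  let L : EuclideanSpace ℝ (Fin d) →ₗ[ℝ] (Fin p → ℝ) × (Unit → ℝ) :=
    { toFun := fun x => (viewPlus π *ᵥ x, fun _ => residualDir π θ S ⬝ᵥ x)
      map_add' := fun x y => by ext <;> simp [dotProduct_add, Matrix.mulVec_add]
      map_smul' := fun c x => by ext <;> simp [dotProduct_smul, Matrix.mulVec_smul] }
  have hL : HasGaussianLaw L P :=
    (IsGaussian.hasGaussianLaw_id (μ := P)).map_fun L.toContinuousLinearMap
  have hmean_obs (a : Fin p) :
      ∫ x : EuclideanSpace ℝ (Fin d), (viewPlus π *ᵥ x) a ∂P = 0 := by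
    simp only [viewPlus_mulVec_apply]
    rw [← eval_integral_piLp fun l => (hP.memLp l).integrable one_le_two, hmean, PiLp.zero_apply]
  refine HasGaussianLaw.indepFun_of_covariance_eval hL fun a _ => ?_
  refine (covariance_eq_sub ((hP.mulVec (viewPlus π)).memLp a)
    (memLp_dotProduct hP.memLp (residualDir π θ S))).trans ?_
  rw [hmean_obs, zero_mul, sub_zero]
  exact (hP.integral_dotProduct_mul_dotProduct _ _).trans
    (congrFun (viewPlus_mulVec_mulVec_residualDir π θ hS) a)

theorem hasScoreCov_of_isGaussian (hS : S.PosDef)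
    (hP : HasSecondMoment (fun x : EuclideanSpace ℝ (Fin d) => x.ofLp) S P)
    (hmean : ∫ x, x ∂P = 0) : HasScoreCov π S θ P := by
  have hobs : Integrable (fun x : EuclideanSpace ℝ (Fin d) =>
      (viewPlus π *ᵥ x) ⬝ᵥ (viewPlus π *ᵥ x)) P :=
    integrable_finsetSum _ fun a _ => ((hP.mulVec (viewPlus π)).memLp a).integrable_mul
      ((hP.mulVec (viewPlus π)).memLp a)
  have hindep := (indepFun_viewPlus_mulVec_residualDir_dotProduct π θ hS hP hmean).comp
    (φ := fun v => v ⬝ᵥ v) (ψ := fun t => t () ^ 2) (by fun_prop) (by fun_prop)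
  simp only [HasScoreCov, dotProduct_residual]
  exact hindep.integrable_mul hobs
    (memLp_dotProduct hP.memLp (residualDir π θ S)).integrable_sq

theorem scoreCov_of_isGaussian (σ : ℝ) (hS : S.PosDef)
    (hP : HasSecondMoment (fun x : EuclideanSpace ℝ (Fin d) => x.ofLp) S P)
    (hmean : ∫ x, x ∂P = 0) :
    scoreCov π S σ θ P = residualVar π S σ θ • blockPlus π S := by
  rw [scoreCov, residualVar, add_smul]
  congr 1
  ext a b
  have hindep := (indepFun_viewPlus_mulVec_residualDir_dotProduct π θ hS hP hmean).comp
    (φ := fun v => v a * v b) (ψ := fun t => t () ^ 2) (by fun_prop) (by fun_prop)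
  have hfactor := hindep.integral_fun_mul_eq_mul_integral
    (by fun_prop) (by fun_prop)
  have hvar : ∫ x : EuclideanSpace ℝ (Fin d), (residualDir π θ S ⬝ᵥ x) ^ 2 ∂P
      = quadForm (schurMinus π S) (viewMinus π *ᵥ θ) := by
    simp only [sq, hP.integral_dotProduct_mul_dotProduct]
    exact quadForm_residualDir π θ hS
  simp only [Function.comp_def] at hfactor
  rw [hvar, (hP.mulVec (viewPlus π)).integral_mul] at hfactor
  rw [Matrix.of_apply, Matrix.smul_apply, smul_eq_mul, mul_comm (quadForm _ _), blockPlus,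
    ← hfactor]
  simp only [dotProduct_residual, mul_right_comm]

end Gaussian

end Collab

theorem mainTheorem5_general {m d : ℕ} (r : Fin m → ℕ)
    (π : ∀ i, Fin (r i) ⊕ Fin (d - r i) ≃ Fin d)
    (hcover : ∀ j : Fin d, ∃ (i : Fin m) (a : Fin (r i)), π i (Sum.inl a) = j)
    (θ : EuclideanSpace ℝ (Fin d)) (σ : ℝ)
    (P : Measure (EuclideanSpace ℝ (Fin d))) [IsProbabilityMeasure P]
    (S : Matrix (Fin d) (Fin d) ℝ) (hS : S.PosDef)
    (hP : Collab.HasSecondMoment (fun x : EuclideanSpace ℝ (Fin d) => x.ofLp) S P)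
    (ν : Measure ℝ) [IsProbabilityMeasure ν] (hν : MemLp id 2 ν) (hν_mean : ∫ e, e ∂ν = 0)
    (hν_sq : ∫ e, e ^ 2 ∂ν = σ ^ 2)
    {Ω : Type*} [MeasurableSpace Ω] (μ : Measure Ω) [IsProbabilityMeasure μ]
    (x : Fin m → ℕ → Ω → EuclideanSpace ℝ (Fin d)) (ε : Fin m → ℕ → Ω → ℝ)
    (hx : ∀ i k, HasLaw (x i k) P μ) (hε : ∀ i k, HasLaw (ε i k) ν μ)
    (hxε : ∀ i k, IndepFun (x i k) (ε i k) μ)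
    (hindep : iIndepFun (fun (s : Fin m × ℕ) ω => (x s.1 s.2 ω, ε s.1 s.2 ω)) μ) :
    (∀ α : Fin m → ℝ, (∀ i, 0 < α i) →
      ∀ᵐ ω ∂μ, Tendsto (fun n => Collab.impGlbEstimator π S θ α n (fun i k => x i k ω)
        fun i k => ε i k ω) atTop (𝓝 θ)) ∧
    ((∀ i, Collab.HasScoreCov (π i) S θ P) →
      ∀ α : Fin m → ℝ, (∀ i, 0 < α i) →
        (Collab.impGlbCov π S σ θ P α).PosSemidef ∧
        TendstoInDistribution
          (fun (n : ℕ) ω => √(n : ℝ) •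
            (Collab.impGlbEstimator π S θ α n (fun i k => x i k ω) (fun i k => ε i k ω) - θ))
          atTop id (fun _ => μ) (multivariateGaussian 0 (Collab.impGlbCov π S σ θ P α)) ∧
        ((∀ i, (Collab.scoreCov (π i) S σ θ P).PosDef) →
          (Collab.impGlbCov π S σ θ P α - Collab.optCov π S σ θ P).PosSemidef)) ∧
    (IsGaussian P → ∫ x, x ∂P = 0 →
      (∀ i, Collab.HasScoreCov (π i) S θ P) ∧
      ((∀ i, 0 < Collab.residualVar (π i) S σ θ) →
        (∀ i, (Collab.scoreCov (π i) S σ θ P).PosDef) ∧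
        Collab.impGlbCov π S σ θ P (fun i => 1 / Collab.residualVar (π i) S σ θ) =
          Collab.optCov π S σ θ P)) := by
  let W (k : ℕ) (ω : Ω) (i : Fin m) : EuclideanSpace ℝ (Fin d) × ℝ := (x i k ω, ε i k ω)
  have hpair (i : Fin m) (k : ℕ) : HasLaw (fun ω => (x i k ω, ε i k ω)) (P.prod ν) μ :=
    (hxε i k).hasLaw_prod (hx i k) (hε i k)
  have hW_indep : iIndepFun W μ := Collab.iIndepFun_curry (fun p => (hpair p.2 p.1).aemeasurable)
    (hindep.precomp (g := Prod.swap) Prod.swap_injective)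
  have hW (k : ℕ) : HasLaw (W k) (Measure.pi fun _ => P.prod ν) μ :=
    iIndepFun.hasLaw_pi (fun i => hpair i k)
      (hindep.precomp (g := fun i => (i, k)) (Prod.mk_left_injective k))
  refine ⟨fun α hα =>
      Collab.tendsto_impGlbEstimator (W := W) hS hcover hα hP hν hν_mean hW_indep hW,
    fun hQ α hα => ?_, fun hgauss hmean => ?_⟩
  · exact ⟨Collab.posSemidef_impGlbCov hS hcover hα
      (Collab.hasSecondMoment_sampleScore π θ α hS hP hν hν_mean hν_sq hQ).posSemidef,
      Collab.tendstoInDistribution_sqrt_smul_impGlbEstimator_sub (W := W) hS hcover hα hP hν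
        hν_mean hν_sq hQ hW_indep hW,
      fun hQ_pos => Collab.posSemidef_impGlbCov_sub_optCov hS hcover hQ_pos hα⟩
  · have hQ (i : Fin m) := Collab.scoreCov_of_isGaussian (π i) θ σ hS hP hmean
    refine ⟨fun i => Collab.hasScoreCov_of_isGaussian (π i) θ hS hP hmean, fun hres => ⟨fun i =>
      hQ i ▸ (Collab.posDef_blockPlus (π i) hS).smul (hres i), ?_⟩⟩
    simpa only [one_div] using Collab.impGlbCov_inv_eq_optCov hS hcover hres hQ

theorem mainTheorem5 {m d : ℕ} (r : Fin m → ℕ)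
    (π : ∀ i, Fin (r i) ⊕ Fin (d - r i) ≃ Fin d)
    -- every feature is observed by some agent
    (hcover : ∀ j : Fin d, ∃ (i : Fin m) (a : Fin (r i)), π i (Sum.inl a) = j)
    (θ : EuclideanSpace ℝ (Fin d)) (σ : ℝ)
    -- the law of a feature vector: mean zero, covariance `S` positive definite
    (P : Measure (EuclideanSpace ℝ (Fin d))) [IsProbabilityMeasure P]
    (S : Matrix (Fin d) (Fin d) ℝ) (hS : S.PosDef)
    (hP : MemLp id 2 P) (hmean : ∫ x, x ∂P = 0)
    (hcov : ∀ j k : Fin d, cov[fun x => x j, fun x => x k; P] = S j k)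
    -- the data
    {Ω : Type*} [MeasurableSpace Ω] (μ : Measure Ω) [IsProbabilityMeasure μ]
    (x : Fin m → ℕ → Ω → EuclideanSpace ℝ (Fin d)) (ε : Fin m → ℕ → Ω → ℝ)
    (hx : ∀ i k, HasLaw (x i k) P μ)
    (hε : ∀ i k, HasLaw (ε i k) (gaussianReal 0 (σ ^ 2).toNNReal) μ)
    (hxε : ∀ i k, IndepFun (x i k) (ε i k) μ)
    (hindep : iIndepFun (fun (s : Fin m × ℕ) ω => (x s.1 s.2 ω, ε s.1 s.2 ω)) μ) :
    -- consistency
    (∀ α : Fin m → ℝ, (∀ i, 0 < α i) →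
      TendstoInMeasure μ
        (fun n ω => Collab.impGlbEstimator π S θ α n (fun i k => x i k ω) (fun i k => ε i k ω))
        atTop (fun _ => θ)) ∧
    -- asymptotic normality
    ((∀ i, Collab.HasScoreCov (π i) S θ P) →
      ∀ α : Fin m → ℝ, (∀ i, 0 < α i) →
        (Collab.impGlbCov π S σ θ P α).PosSemidef ∧
        TendstoInDistribution
          (fun (n : ℕ) ω => √(n : ℝ) •
            (Collab.impGlbEstimator π S θ α n (fun i k => x i k ω) (fun i k => ε i k ω) - θ))
          atTop id (fun _ => μ) (multivariateGaussian 0 (Collab.impGlbCov π S σ θ P α))) ∧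
    -- Gaussian features
    (P = multivariateGaussian 0 S →
      (∀ i, Collab.HasScoreCov (π i) S θ P) ∧
      ((∀ i, 0 < Collab.residualVar (π i) S σ θ) →
        (∀ α : Fin m → ℝ, (∀ i, 0 < α i) →
          (Collab.impGlbCov π S σ θ P α - Collab.optCov π S σ θ P).PosSemidef) ∧
        Collab.impGlbCov π S σ θ P (fun i => 1 / Collab.residualVar (π i) S σ θ) =
          Collab.optCov π S σ θ P)) := by
  have hσ : ∫ e, e ^ 2 ∂gaussianReal 0 (σ ^ 2).toNNReal = σ ^ 2 :=
    (variance_of_integral_eq_zero aemeasurable_id integral_id_gaussianReal).symm.trans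
      (variance_id_gaussianReal.trans (Real.coe_toNNReal _ (sq_nonneg σ)))
  obtain ⟨hcons, hnormal, hgauss⟩ := mainTheorem5_general r π hcover θ σ P S hS
    (.of_covariance_eq hP hmean hcov) (gaussianReal 0 (σ ^ 2).toNNReal) (memLp_id_gaussianReal 2)
    integral_id_gaussianReal hσ μ x ε hx hε hxε hindep
  refine ⟨fun α hα => tendstoInMeasure_of_tendsto_ae (fun n =>
      (Collab.aemeasurable_impGlbEstimator hS.isHermitian (fun i k => (hx i k).aemeasurable)
        (fun i k => (hε i k).aemeasurable) n).aestronglyMeasurable) (hcons α hα),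
    fun hQ α hα => ⟨(hnormal hQ α hα).1, (hnormal hQ α hα).2.1⟩, fun hPG => ?_⟩
  obtain ⟨hQ, hopt⟩ := hgauss (hPG ▸ inferInstance) hmean
  exact ⟨hQ, fun hres => ⟨fun α hα => (hnormal hQ α hα).2.2 (hopt hres).1, (hopt hres).2⟩⟩
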